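/- Let $k\ge 1$ be an integer and put $$\gamma_k = 8k^2\,(4k^2+2)\,\bigl(2(4k)^{4k}+1\bigr)\,\bigl(2(6k^2)^{3k}+14k\bigr).$$ Let $D$ be a finite strong digraph, i.e. one in which for any two vertices $u,v$ there is a directed path from $u$ to $v$. If $\chi(D)>\gamma_k$, where $\chi(D)$ denotes the chromatic number of the underlying undirected graph of $D$, then $D$ contains a subdivision of $B(k,1;k)$: there are distinct vertices $x,y$ of $D$, two different $(x,y)$-dipaths, one of length at least $k$ and the other of arbitrary length (at least $1$), and a $(y,x)$-dipath of length at least $k$, such that the three dipaths are pairwise internally disjoint (any vertex common to two of them is $x$ or $y$). In particular, for every $k\geq 1$ there is a constant $\gamma_k$, depending only on $k$, such that every finite strong digraph $D$ with $\chi(D) > \gamma_k$ contains a subdivision of $B(k,1;k)$. -/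

import Mathlib

namespace Digraph

variable {V : Type*}

/-- The chromatic number of a digraph: the chromatic number of its underlying undirected graph. -/
noncomputable def chi (D : Digraph V) : ℕ∞ :=
  D.toSimpleGraphInclusive.chromaticNumber

/-- The list `P` is the vertex sequence of a directed path of `D` from `x` to `y`: it starts in
`x`, ends in `y`, has no repeated vertex, and each vertex is joined by an arc of `D` to the next. -/
structure IsDipath (D : Digraph V) (x y : V) (P : List V) : Prop where
  head : P.head? = some x
  last : P.getLast? = some y
  nodup : P.Nodup
  chain : P.IsChain D.Adj

/-- The length (number of arcs) of the path with vertex sequence `P`. -/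
def pathLength (P : List V) : ℕ := P.length - 1

/-- A digraph is strong if for any two vertices `x`, `y` there is a directed path
from `x` to `y`. -/
def IsStrong (D : Digraph V) : Prop := ∀ x y : V, ∃ P : List V, D.IsDipath x y P

/-- Two paths with both ends in `{x, y}` are internally disjoint. -/
def InternallyDisjoint (x y : V) (P Q : List V) : Prop :=
  ∀ v ∈ P, v ∈ Q → v = x ∨ v = y

/-- `D` contains a subdivision of `B(k₁, k₂; k₃)`: there are two distinct vertices `x`, `y`, two
different `(x, y)`-dipaths `P`, `Q` of lengths at least `k₁` and `k₂`, and a `(y, x)`-dipath `R`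
of length at least `k₃`, the three being pairwise internally disjoint.
(Two `(x, y)`-dipaths that are internally disjoint can only coincide if both are the single arc
`xy`, which must not be used twice.) -/
def ContainsBispindle (D : Digraph V) (k₁ k₂ k₃ : ℕ) : Prop :=
  ∃ (x y : V) (P Q R : List V), x ≠ y ∧
    D.IsDipath x y P ∧ D.IsDipath x y Q ∧ D.IsDipath y x R ∧
    P ≠ Q ∧
    InternallyDisjoint x y P Q ∧ InternallyDisjoint x y P R ∧ InternallyDisjoint x y Q R ∧
    k₁ ≤ pathLength P ∧ k₂ ≤ pathLength Q ∧ k₃ ≤ pathLength R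

/-- The constant `γ_k`. -/
def bispindleBound (k : ℕ) : ℕ :=
  8 * k ^ 2 * (4 * k ^ 2 + 2) * (2 * (4 * k) ^ (4 * k) + 1) *
    (2 * (6 * k ^ 2) ^ (3 * k) + 14 * k)

end Digraph

/-! Suppose `2 ≤ k` and `D` has no bispindle; the claim becomes an upper bound for the chromatic
number. Split the vertices successively into maximal parts that are built from a single vertex by
attaching ears of length at least `2 * k`, and contract the parts. A long cycle of the quotient,
read from its earliest part, would lift to a further long ear on that part, against maximality. So
the quotient is strong with short cycles, and a theorem in the manner of Bondy
(`colorable_of_cycle_length_le`) bounds its chromatic number. It remains to colour each part and to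
take pairs of colours.

In a part, the predecessors on the ears form an out-tree and the successors an in-tree. Each vertex
`w` other than the root lies on a cycle: along the in-tree to the first out-tree ancestor of `w`,
then down the out-tree. A path that leaves this cycle at least `k` steps after `w` and comes back to
it exactly at `w` gives a bispindle, unless both that path and the rest of the cycle are shorter
than `k`. Hence a path from the root to `w` that avoids the first `k` in-tree vertices from `w`
passes, fewer than `k` steps before `w`, a vertex closely tied to `w` by the two trees
(`exists_near_of_path`).

Consequently a vertex far from both ends of its ear has no arc to or from an earlier ear, and chords
between such vertices are short; positions modulo `k` colour them. Vertices near the start of their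
ear are grouped by position and by a local colour that rules out near coincidences. In a group,
chains of arcs to later ears are short. So are chains to earlier ears, unless they meet an out-tree
ancestor of their start; the first such ancestor is unique (`false_of_two_paths_to_ancestors`), so
two further colours break these chains. Vertices near the end of their ear follow by reversing all
arcs. -/

namespace Digraph

variable {V : Type*}

/-! ### Directed paths inside prescribed vertex sets -/

/-- There is a directed path from `x` to `y` of length at least `n` all of whose vertices lie
in `X`. -/
def HasPath (D : Digraph V) (X : Set V) (x y : V) (n : ℕ) : Prop :=
  ∃ P : List V, D.IsDipath x y P ∧ (∀ v ∈ P, v ∈ X) ∧ n ≤ pathLength P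

theorem IsDipath.start_mem {D : Digraph V} {x y : V} {P : List V} (h : D.IsDipath x y P) :
    x ∈ P := List.mem_of_mem_head? h.head

theorem HasPath.mono {D : Digraph V} {X Y : Set V} {x y : V} {m n : ℕ} (h : D.HasPath X x y m)
    (hXY : X ⊆ Y) (hmn : n ≤ m) : D.HasPath Y x y n := by
  obtain ⟨P, hP, hX, hm⟩ := h
  exact ⟨P, hP, fun v hv => hXY (hX v hv), hmn.trans hm⟩

theorem HasPath.trans {D : Digraph V} {X Y : Set V} {x y z : V} {m n : ℕ}
    (h₁ : D.HasPath X x y m) (h₂ : D.HasPath Y y z n) (hXY : ∀ v ∈ X, v ∈ Y → v = y) :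
    D.HasPath (X ∪ Y) x z (m + n) := by
  obtain ⟨P, hP, hPX, hm⟩ := h₁
  obtain ⟨Q, hQ, hQY, hn⟩ := h₂
  obtain ⟨Q', rfl⟩ : ∃ Q', Q = y :: Q' := by
    cases Q with
    | nil => simpa using hQ.head
    | cons a Q' => exact ⟨Q', by simpa using hQ.head⟩
  have hnd := List.nodup_cons.1 hQ.nodup
  have hPne : P ≠ [] := List.ne_nil_of_mem hP.start_mem
  refine ⟨P ++ Q', ⟨?_, ?_, ?_, ?_⟩, ?_, ?_⟩
  · rw [List.head?_append_of_ne_nil _ hPne, hP.head]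
  · cases Q' with
    | nil => have := hQ.last; simp_all [hP.last]
    | cons b Q'' =>
      rw [List.getLast?_append_of_ne_nil _ (by simp), ← hQ.last]
      simp [List.getLast?_cons_cons]
  · refine List.nodup_append'.2 ⟨hP.nodup, hnd.2, ?_⟩
    intro v hv hv'
    have := hXY v (hPX v hv) (hQY v (by simp [hv']))
    subst this
    exact hnd.1 hv'
  · refine List.isChain_append.2 ⟨hP.chain, hQ.chain.tail, ?_⟩
    intro a ha b hb
    rw [hP.last] at ha
    cases ha
    cases Q' with
    | nil => simp at hb
    | cons c Q'' =>
      simp only [List.head?_cons, Option.mem_def, Option.some.injEq] at hb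
      subst hb
      have := hQ.chain
      simp only [List.isChain_cons_cons] at this
      exact this.1
  · intro v hv
    rcases List.mem_append.1 hv with hv | hv
    · exact Or.inl (hPX v hv)
    · exact Or.inr (hQY v (by simp [hv]))
  · unfold pathLength at *
    have : 0 < P.length := List.length_pos_of_ne_nil hPne
    simp only [List.length_append, List.length_cons] at *
    omega

theorem HasPath.arc {D : Digraph V} {x y : V} (hxy : x ≠ y) (h : D.Adj x y) :
    D.HasPath {x, y} x y 1 :=
  ⟨[x, y], ⟨rfl, rfl, by simp [hxy], by simp [h]⟩, by simp, by simp [pathLength]⟩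

theorem HasPath.of_fun {D : Digraph V} (f : ℕ → V) (n : ℕ)
    (hadj : ∀ i < n, D.Adj (f i) (f (i + 1)))
    (hinj : ∀ i j, i < j → j ≤ n → f i ≠ f j) :
    D.HasPath {v | ∃ i ≤ n, v = f i} (f 0) (f n) n := by
  refine ⟨(List.range (n + 1)).map f, ⟨?_, ?_, ?_, ?_⟩, ?_, ?_⟩
  · rw [List.range_succ_eq_map]; simp
  · rw [List.range_succ]; simp
  · refine List.Nodup.map_on ?_ List.nodup_range
    intro i hi j hj hij
    simp only [List.mem_range] at hi hj
    by_contra hne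
    rcases Nat.lt_or_gt_of_ne hne with h | h
    · exact hinj i j h (by omega) hij
    · exact hinj j i h (by omega) hij.symm
  · rw [List.isChain_map, List.isChain_range_succ]
    exact hadj
  · intro v hv
    obtain ⟨i, hi, rfl⟩ := List.mem_map.1 hv
    exact ⟨i, by simpa [Nat.lt_succ_iff] using hi, rfl⟩
  · simp [pathLength]

theorem HasPath.of_fun_segment {D : Digraph V} (f : ℕ → V) (m n : ℕ) (hmn : m ≤ n)
    (hadj : ∀ i, m ≤ i → i < n → D.Adj (f i) (f (i + 1)))
    (hinj : ∀ i j, m ≤ i → i < j → j ≤ n → f i ≠ f j) :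
    D.HasPath {v | ∃ i, m ≤ i ∧ i ≤ n ∧ v = f i} (f m) (f n) (n - m) := by
  have h := HasPath.of_fun (D := D) (fun i => f (m + i)) (n - m)
    (fun i hi => hadj _ (by omega) (by omega))
    (fun i j hij hj => hinj _ _ (by omega) (by omega) (by omega))
  simp only [Nat.add_zero, Nat.add_sub_cancel' hmn] at h
  refine h.mono ?_ le_rfl
  rintro v ⟨i, hi, rfl⟩
  exact ⟨m + i, by omega, by omega, rfl⟩

/-- A path along a sequence traversed backwards. -/
theorem HasPath.of_fun_reverse {D : Digraph V} (f : ℕ → V) (m n : ℕ) (hmn : m ≤ n)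
    (hadj : ∀ i, m ≤ i → i < n → D.Adj (f (i + 1)) (f i))
    (hinj : ∀ i j, m ≤ i → i < j → j ≤ n → f i ≠ f j) :
    D.HasPath {v | ∃ i, m ≤ i ∧ i ≤ n ∧ v = f i} (f n) (f m) (n - m) := by
  have h := HasPath.of_fun (D := D) (fun i => f (n - i)) (n - m)
    (fun i hi => by
      have := hadj (n - (i + 1)) (by omega) (by omega)
      rwa [show n - (i + 1) + 1 = n - i by omega] at this)
    (fun i j hij hj => (hinj (n - j) (n - i) (by omega) (by omega) (by omega)).symm)
  simp only [Nat.sub_zero, Nat.sub_sub_self hmn] at h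
  refine h.mono ?_ le_rfl
  rintro v ⟨i, hi, rfl⟩
  exact ⟨n - i, by omega, by omega, rfl⟩

/-- For `2 ≤ k` distinctness of the two `(x, y)`-dipaths is automatic: if they coincided,
disjointness would confine them to `{x, y}`, which leaves room for length at most one. -/
theorem ContainsBispindle.of_hasPath {D : Digraph V} {k : ℕ} (hk : 2 ≤ k) {X Y Z : Set V} {x y : V}
    (hxy : x ≠ y) (hP : D.HasPath X x y k) (hQ : D.HasPath Y x y 1) (hR : D.HasPath Z y x k)
    (hXY : ∀ v ∈ X, v ∈ Y → v = x ∨ v = y) (hXZ : ∀ v ∈ X, v ∈ Z → v = x ∨ v = y)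
    (hYZ : ∀ v ∈ Y, v ∈ Z → v = x ∨ v = y) : D.ContainsBispindle k 1 k := by
  obtain ⟨P, hP, hPX, hPk⟩ := hP
  obtain ⟨Q, hQ, hQY, hQk⟩ := hQ
  obtain ⟨R, hR, hRZ, hRk⟩ := hR
  refine ⟨x, y, P, Q, R, hxy, hP, hQ, hR, ?_, fun v h h' => hXY v (hPX v h) (hQY v h'),
    fun v h h' => hXZ v (hPX v h) (hRZ v h'), fun v h h' => hYZ v (hQY v h) (hRZ v h'),
    hPk, hQk, hRk⟩
  rintro rfl
  have hsub : P ⊆ [x, y] := fun v hv => by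
    simpa using hXY v (hPX v hv) (hQY v hv)
  have := (hP.nodup.subperm hsub).length_le
  unfold pathLength at hPk
  simp at this
  omega

/-- As `ContainsBispindle.of_hasPath`, with the long path among the two not specified. -/
theorem ContainsBispindle.of_hasPath' {D : Digraph V} {k : ℕ} (hk : 2 ≤ k) {X Y Z : Set V}
    {x y : V} {m n : ℕ} (hm : 1 ≤ m) (hn : 1 ≤ n) (hmn : k ≤ m ∨ k ≤ n)
    (hxy : x ≠ y) (hP : D.HasPath X x y m) (hQ : D.HasPath Y x y n) (hR : D.HasPath Z y x k)
    (hXY : ∀ v ∈ X, v ∈ Y → v = x ∨ v = y) (hXZ : ∀ v ∈ X, v ∈ Z → v = x ∨ v = y)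
    (hYZ : ∀ v ∈ Y, v ∈ Z → v = x ∨ v = y) : D.ContainsBispindle k 1 k := by
  rcases hmn with h | h
  · exact .of_hasPath hk hxy (hP.mono subset_rfl h) (hQ.mono subset_rfl hn) hR hXY hXZ hYZ
  · exact .of_hasPath hk hxy (hQ.mono subset_rfl h) (hP.mono subset_rfl hm) hR
      (fun v h h' => hXY v h' h) hYZ hXZ

/-! ### Reversal and induced subdigraphs -/

/-- The digraph with all arcs reversed. -/
def rev (D : Digraph V) : Digraph V := ⟨fun a b => D.Adj b a⟩

theorem IsDipath.of_rev {D : Digraph V} {x y : V} {P : List V} (h : D.rev.IsDipath x y P) :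
    D.IsDipath y x P.reverse :=
  ⟨by rw [List.head?_reverse, h.last], by rw [List.getLast?_reverse, h.head],
    List.nodup_reverse.2 h.nodup, List.isChain_reverse.2 h.chain⟩

theorem ContainsBispindle.of_rev {D : Digraph V} {k₁ k₂ k₃ : ℕ}
    (h : D.rev.ContainsBispindle k₁ k₂ k₃) : D.ContainsBispindle k₁ k₂ k₃ := by
  obtain ⟨x, y, P, Q, R, hxy, hP, hQ, hR, hne, h₁, h₂, h₃, l₁, l₂, l₃⟩ := h
  refine ⟨y, x, P.reverse, Q.reverse, R.reverse, hxy.symm, hP.of_rev, hQ.of_rev, hR.of_rev,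
    fun h => hne (List.reverse_injective h), ?_, ?_, ?_, ?_, ?_, ?_⟩
  · intro v hv hv'; exact (h₁ v (by simpa using hv) (by simpa using hv')).symm
  · intro v hv hv'; exact (h₂ v (by simpa using hv) (by simpa using hv')).symm
  · intro v hv hv'; exact (h₃ v (by simpa using hv) (by simpa using hv')).symm
  all_goals simpa [pathLength] using ‹_›

/-- The subdigraph induced by a set of vertices. -/
def induce (D : Digraph V) (S : Set V) : Digraph S := ⟨fun a b => D.Adj a b⟩

theorem IsDipath.of_induce {D : Digraph V} {S : Set V} {x y : S} {P : List S}
    (h : (D.induce S).IsDipath x y P) : D.IsDipath (x : V) y (P.map Subtype.val) :=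
  ⟨by rw [List.head?_map, h.head]; rfl, by rw [List.getLast?_map, h.last]; rfl,
    h.nodup.map Subtype.val_injective, (List.isChain_map _).2 h.chain⟩

theorem ContainsBispindle.of_induce {D : Digraph V} {S : Set V} {k₁ k₂ k₃ : ℕ}
    (h : (D.induce S).ContainsBispindle k₁ k₂ k₃) : D.ContainsBispindle k₁ k₂ k₃ := by
  obtain ⟨x, y, P, Q, R, hxy, hP, hQ, hR, hne, h₁, h₂, h₃, l₁, l₂, l₃⟩ := h
  have key : ∀ A B : List S, InternallyDisjoint x y A B →
      InternallyDisjoint (x : V) y (A.map Subtype.val) (B.map Subtype.val) := by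
    intro A B hAB v hv hv'
    obtain ⟨a, ha, rfl⟩ := List.mem_map.1 hv
    obtain ⟨b, hb, hab⟩ := List.mem_map.1 hv'
    obtain rfl : b = a := Subtype.ext hab
    exact (hAB b ha hb).imp (congrArg _) (congrArg _)
  refine ⟨x, y, _, _, _, fun h => hxy (Subtype.ext h), hP.of_induce, hQ.of_induce, hR.of_induce,
    fun h => hne (List.map_injective_iff.2 Subtype.val_injective h), ?_⟩
  exact ⟨fun v => key P Q h₁ v, fun v => key P R h₂ v,
    fun v => key Q R h₃ v, by simpa [pathLength] using l₁, by simpa [pathLength] using l₂,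
    by simpa [pathLength] using l₃⟩

theorem ContainsBispindle.mono {D : Digraph V} {k₁ k₂ k₃ l₁ l₂ l₃ : ℕ}
    (h : D.ContainsBispindle l₁ l₂ l₃) (h₁ : k₁ ≤ l₁) (h₂ : k₂ ≤ l₂) (h₃ : k₃ ≤ l₃) :
    D.ContainsBispindle k₁ k₂ k₃ := by
  obtain ⟨x, y, P, Q, R, hxy, hP, hQ, hR, hne, d₁, d₂, d₃, m₁, m₂, m₃⟩ := h
  exact ⟨x, y, P, Q, R, hxy, hP, hQ, hR, hne, d₁, d₂, d₃, h₁.trans m₁, h₂.trans m₂, h₃.trans m₃⟩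

/-! ### Ear systems and their two trees -/

/-- A decomposition of a digraph into ears. Starting from the vertex `root`, directed paths of
length at least `L` (the ears) are added one after the other; each of them starts and ends in
vertices that are already there, and its inner vertices are new. For an inner vertex `v` of an ear,
`time v` is the number of that ear, `par v` and `nxt v` are the vertices before and after `v` on the
ear, and `pos v` and `copos v` are the distances of `v` on the ear to its two ends.
The maps `par` and `nxt` define a spanning out-tree and a spanning in-tree with root `root`, in which
`v` has level `depth v` and `height v`. -/
structure EarSystem (D : Digraph V) (L : ℕ) where
  root : V
  time : V → ℕ
  pos : V → ℕ
  copos : V → ℕ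
  depth : V → ℕ
  height : V → ℕ
  par : V → V
  nxt : V → V
  par_root : par root = root
  nxt_root : nxt root = root
  depth_root : depth root = 0
  height_root : height root = 0
  time_root : time root = 0
  time_pos : ∀ v, v ≠ root → 0 < time v
  adj_par : ∀ v, v ≠ root → D.Adj (par v) v
  adj_nxt : ∀ v, v ≠ root → D.Adj v (nxt v)
  depth_par : ∀ v, v ≠ root → depth v = depth (par v) + 1
  height_nxt : ∀ v, v ≠ root → height v = height (nxt v) + 1
  par_cases : ∀ v, v ≠ root → (time (par v) < time v ∧ pos v = 1) ∨
    (time (par v) = time v ∧ pos v = pos (par v) + 1 ∧ copos (par v) = copos v + 1 ∧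
      nxt (par v) = v)
  nxt_cases : ∀ v, v ≠ root → (time (nxt v) < time v ∧ copos v = 1) ∨
    (time (nxt v) = time v ∧ copos v = copos (nxt v) + 1 ∧ pos (nxt v) = pos v + 1 ∧
      par (nxt v) = v)
  pos_inj : ∀ u v, time u = time v → pos u = pos v → u = v
  copos_inj : ∀ u v, time u = time v → copos u = copos v → u = v
  length_le : ∀ v, v ≠ root → L ≤ pos v + copos v

namespace EarSystem

variable {D : Digraph V} {L : ℕ}

/-- The ear decomposition of the reversed digraph. -/
def reverse (E : EarSystem D L) : EarSystem D.rev L where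
  root := E.root
  time := E.time
  pos := E.copos
  copos := E.pos
  depth := E.height
  height := E.depth
  par := E.nxt
  nxt := E.par
  par_root := E.nxt_root
  nxt_root := E.par_root
  depth_root := E.height_root
  height_root := E.depth_root
  time_root := E.time_root
  time_pos := E.time_pos
  adj_par := E.adj_nxt
  adj_nxt := E.adj_par
  depth_par := E.height_nxt
  height_nxt := E.depth_par
  par_cases := E.nxt_cases
  nxt_cases := E.par_cases
  pos_inj := E.copos_inj
  copos_inj := E.pos_inj
  length_le v hv := (E.length_le v hv).trans_eq (add_comm _ _)

variable (E : EarSystem D L)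

theorem ne_root_of_time {v : V} (h : 0 < E.time v) : v ≠ E.root := by
  rintro rfl
  exact absurd E.time_root h.ne'

theorem depth_eq_zero {v : V} (h : E.depth v = 0) : v = E.root := by
  by_contra hv
  have := E.depth_par v hv
  omega

theorem depth_pos {v : V} (hv : v ≠ E.root) : 0 < E.depth v :=
  Nat.pos_of_ne_zero fun h => hv (E.depth_eq_zero h)

theorem depth_iterate (v : V) (i : ℕ) : E.depth (E.par^[i] v) = E.depth v - i := by
  induction i with
  | zero => rfl
  | succ i ih =>
    rw [Function.iterate_succ_apply']
    by_cases h : E.par^[i] v = E.root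
    · rw [h, E.par_root, E.depth_root]
      rw [h, E.depth_root] at ih
      omega
    · have := E.depth_par _ h
      omega

theorem par_iterate_eq_root_iff {v : V} {i : ℕ} : E.par^[i] v = E.root ↔ E.depth v ≤ i := by
  have := E.depth_iterate v i
  constructor
  · intro h
    rw [h, E.depth_root] at this
    omega
  · intro h
    exact E.depth_eq_zero (by omega)

theorem par_iterate_inj {v : V} {i j : ℕ} (hi : i ≤ E.depth v) (hj : j ≤ E.depth v)
    (h : E.par^[i] v = E.par^[j] v) : i = j := by
  have hi' := E.depth_iterate v i
  have hj' := E.depth_iterate v j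
  rw [h] at hi'
  omega

/-- Each step lowers the depth by one until the root, where `par` is stationary; only there can
different exponents agree. -/
theorem eq_of_par_iterate_eq {v : V} {i j : ℕ} (h : E.par^[i] v = E.par^[j] v)
    (hr : E.par^[i] v ≠ E.root) : i = j := by
  have hi := E.par_iterate_eq_root_iff (v := v) (i := i)
  have hj := E.par_iterate_eq_root_iff (v := v) (i := j)
  rw [← h] at hj
  exact E.par_iterate_inj (by by_contra! h'; exact hr (hi.2 h'.le))
    (by by_contra! h'; exact hr (hj.2 h'.le)) h

theorem time_par_le (v : V) : E.time (E.par v) ≤ E.time v := by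
  by_cases h : v = E.root
  · rw [h, E.par_root]
  · rcases E.par_cases v h with h | h <;> omega

theorem time_par_iterate_le (v : V) (i : ℕ) : E.time (E.par^[i] v) ≤ E.time v := by
  induction i with
  | zero => rfl
  | succ i ih =>
    rw [Function.iterate_succ_apply']
    exact (E.time_par_le _).trans ih

theorem time_nxt_iterate_le (v : V) (i : ℕ) : E.time (E.nxt^[i] v) ≤ E.time v :=
  E.reverse.time_par_iterate_le v i

theorem pos_pos {v : V} (hv : v ≠ E.root) : 0 < E.pos v := by
  rcases E.par_cases v hv with h | h <;> omega

/-- Fewer than `pos v` steps back do not leave the ear, and on an ear `nxt` undoes `par`. Read in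
the reversed system, a vertex a few in-tree steps behind another one is its out-tree ancestor. -/
theorem par_iterate_of_lt_pos {v : V} (hv : v ≠ E.root) {i : ℕ} (hi : i < E.pos v) :
    E.time (E.par^[i] v) = E.time v ∧ E.pos (E.par^[i] v) + i = E.pos v ∧
      E.copos (E.par^[i] v) = E.copos v + i ∧ E.nxt^[i] (E.par^[i] v) = v := by
  induction i with
  | zero => simp
  | succ i ih =>
    obtain ⟨h₁, h₂, h₃, h₄⟩ := ih (by omega)
    have hr : E.par^[i] v ≠ E.root := E.ne_root_of_time (h₁ ▸ E.time_pos v hv)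
    rw [Function.iterate_succ_apply' E.par]
    rcases E.par_cases _ hr with h | ⟨a, b, c, d⟩
    · omega
    · refine ⟨by omega, by omega, by omega, ?_⟩
      rw [Function.iterate_succ_apply, d, h₄]

theorem nxt_iterate_of_lt_copos {v : V} (hv : v ≠ E.root) {i : ℕ} (hi : i < E.copos v) :
    E.time (E.nxt^[i] v) = E.time v ∧ E.copos (E.nxt^[i] v) + i = E.copos v ∧
      E.pos (E.nxt^[i] v) = E.pos v + i ∧ E.par^[i] (E.nxt^[i] v) = v :=
  E.reverse.par_iterate_of_lt_pos hv hi

theorem time_par_iterate_lt {v : V} (hv : v ≠ E.root) {i : ℕ} (hi : E.pos v ≤ i) :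
    E.time (E.par^[i] v) < E.time v := by
  obtain ⟨j, rfl⟩ := Nat.exists_eq_add_of_le' hi
  rw [Function.iterate_add_apply]
  refine (E.time_par_iterate_le _ _).trans_lt ?_
  have hp := E.pos_pos hv
  obtain ⟨h₁, h₂, -, -⟩ := E.par_iterate_of_lt_pos hv (i := E.pos v - 1) (by omega)
  have hr : E.par^[E.pos v - 1] v ≠ E.root := E.ne_root_of_time (h₁ ▸ E.time_pos v hv)
  rw [show E.pos v = E.pos v - 1 + 1 by omega, Function.iterate_succ_apply']
  rcases E.par_cases _ hr with h | ⟨a, b, c, d⟩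
  · omega
  · have := E.pos_pos (v := E.par (E.par^[E.pos v - 1] v))
      (E.ne_root_of_time (by rw [a, h₁]; exact E.time_pos v hv))
    omega

theorem time_nxt_iterate_lt {v : V} (hv : v ≠ E.root) {i : ℕ} (hi : E.copos v ≤ i) :
    E.time (E.nxt^[i] v) < E.time v :=
  E.reverse.time_par_iterate_lt hv hi

theorem nxt_iterate_ne_self {v : V} (hv : v ≠ E.root) {i : ℕ} (hi : 0 < i) :
    E.nxt^[i] v ≠ v := by
  intro h
  have : (0 : ℕ) = i := E.reverse.eq_of_par_iterate_eq (v := v) (i := 0) (j := i) h.symm hv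
  omega

theorem par_iterate_ne_self {v : V} (hv : v ≠ E.root) {i : ℕ} (hi : 0 < i) :
    E.par^[i] v ≠ v := E.reverse.nxt_iterate_ne_self hv hi

/-- The cycle through `w` that follows the in-tree up to the first vertex above `w` in the out-tree,
and from there returns to `w` in the out-tree. -/
theorem exists_cycle {w : V} (hw : w ≠ E.root) :
    ∃ (c : ℕ → V) (a n : ℕ), E.copos w ≤ a ∧ a + E.pos w ≤ n ∧ a ≤ E.height w ∧
      n - a ≤ E.depth w ∧ c 0 = w ∧ c n = w ∧
      (∀ t < n, D.Adj (c t) (c (t + 1))) ∧ (∀ s t, s < t → t < n → c s ≠ c t) ∧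
      (∀ t ≤ a, c t = E.nxt^[t] w) ∧ (∀ t, a ≤ t → t ≤ n → c t = E.par^[n - t] w) ∧
      ∀ i j, 1 ≤ i → i < a → E.nxt^[i] w ≠ E.par^[j] w := by
  classical
  -- The root lies on both tree paths, so they meet. The bound on `b` matters because `par` is
  -- stationary at the root, and repetitions there would spoil injectivity.
  have hex : ∃ a, 1 ≤ a ∧ ∃ b ≤ E.depth w, E.nxt^[a] w = E.par^[b] w := by
    refine ⟨E.height w, E.reverse.depth_pos hw, E.depth w, le_rfl, ?_⟩
    rw [E.par_iterate_eq_root_iff.2 le_rfl]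
    exact E.reverse.par_iterate_eq_root_iff.2 le_rfl
  obtain ⟨ha1, b, hb, hab⟩ := Nat.find_spec hex
  set a := Nat.find hex with ha
  have hah : a ≤ E.height w := Nat.find_min' hex ⟨E.reverse.depth_pos hw, E.depth w, le_rfl, by
    rw [E.par_iterate_eq_root_iff.2 le_rfl]
    exact E.reverse.par_iterate_eq_root_iff.2 le_rfl⟩
  have hfirst : ∀ i j, 1 ≤ i → i < a → E.nxt^[i] w ≠ E.par^[j] w := by
    intro i j hi hia h
    rcases le_total j (E.depth w) with hj | hj
    · exact Nat.find_min hex hia ⟨hi, j, hj, h⟩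
    · refine Nat.find_min hex hia ⟨hi, E.depth w, le_rfl, ?_⟩
      rw [h, E.par_iterate_eq_root_iff.2 le_rfl, E.par_iterate_eq_root_iff.2 hj]
  -- While the in-tree path stays on the ear of `w`, `par` retraces it to `w`; a meeting there would
  -- make the out-tree path from `w` return to `w`.
  have hca : E.copos w ≤ a := by
    by_contra! h
    have h4 := (E.nxt_iterate_of_lt_copos hw h).2.2.2
    rw [hab, ← Function.iterate_add_apply] at h4
    exact E.par_iterate_ne_self hw (by omega) h4
  -- The meeting vertex belongs to an earlier ear, whereas fewer than `pos w` steps in the out-tree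
  -- stay on the ear of `w`.
  have hpb : E.pos w ≤ b := by
    by_contra! h
    have h1 := (E.par_iterate_of_lt_pos hw h).1
    have h2 := E.time_nxt_iterate_lt hw hca
    rw [hab] at h2
    omega
  have hinjN : ∀ i j, i < j → j ≤ a → E.nxt^[i] w ≠ E.nxt^[j] w := fun i j hij hj h =>
    hij.ne (E.reverse.par_iterate_inj (by change i ≤ E.height w; omega)
      (by change j ≤ E.height w; omega) h)
  have hinjP : ∀ i j, i < j → j ≤ b → E.par^[i] w ≠ E.par^[j] w := fun i j hij hj h =>
    hij.ne (E.par_iterate_inj (by omega) (by omega) h)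
  refine ⟨fun t => if t ≤ a then E.nxt^[t] w else E.par^[a + b - t] w, a, a + b, hca, by omega, hah,
    by omega, by simp, ?_, ?_, ?_, ?_, ?_, hfirst⟩
  · have := E.pos_pos hw
    simp only [show ¬ a + b ≤ a by omega, if_false]
    simp
  · intro t ht
    dsimp only
    rcases lt_or_ge t a with h | h
    · rw [if_pos h.le, if_pos (Nat.succ_le_of_lt h), Function.iterate_succ_apply']
      refine E.adj_nxt _ fun hr => ?_
      have := E.reverse.par_iterate_eq_root_iff.1 hr
      change E.height w ≤ t at this
      omega
    · have h1 : (if t ≤ a then E.nxt^[t] w else E.par^[a + b - t] w) =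
          E.par^[a + b - (t + 1) + 1] w := by
        rw [show a + b - (t + 1) + 1 = a + b - t by omega]
        split_ifs with h'
        · obtain rfl : t = a := by omega
          rw [hab]
          congr 2; omega
        · rfl
      rw [h1, if_neg (by omega), Function.iterate_succ_apply']
      refine E.adj_par _ fun hr => ?_
      have := E.par_iterate_eq_root_iff.1 hr
      omega
  · intro s t hst ht
    dsimp only
    split_ifs with h1 h2 h2
    · exact hinjN s t hst h2
    · intro h
      rcases Nat.eq_zero_or_pos s with rfl | hs
      · exact hinjP 0 (a + b - t) (by omega) (by omega) h
      · rcases h1.lt_or_eq with h1 | rfl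
        · exact hfirst s _ hs h1 h
        · rw [hab] at h
          exact hinjP _ _ (by omega) (by omega) h.symm
    · omega
    · exact (hinjP _ _ (by omega) (by omega)).symm
  · intro t ht
    simp [ht]
  · intro t h1 h2
    dsimp only
    split_ifs with h
    · obtain rfl : t = a := by omega
      rw [hab]
      congr 2; omega
    · rfl

end EarSystem

/-! ### Cycles with an ear, and paths returning to their cycle -/

/-- A cycle together with an ear from `c t` to `c 0`. -/
theorem ContainsBispindle.of_cycle_of_ear {D : Digraph V} {k : ℕ} (hk : 2 ≤ k) {c : ℕ → V} {n : ℕ}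
    (hadj : ∀ t < n, D.Adj (c t) (c (t + 1))) (hinj : ∀ s t, s < t → t < n → c s ≠ c t)
    (hn : c n = c 0) {t : ℕ} (ht : k ≤ t) (htn : t < n) {Y : Set V} {m : ℕ}
    (hQ : D.HasPath Y (c t) (c 0) m) (hm : 1 ≤ m) (hlong : k ≤ n - t ∨ k ≤ m)
    (hY : ∀ s < n, c s ∈ Y → s = t ∨ s = 0) : D.ContainsBispindle k 1 k := by
  -- The branch vertices are `c t` and `c 0`: the two paths from `c t` are the rest of the cycle and
  -- the ear, and the initial segment of the cycle leads back.
  have hR := HasPath.of_fun_segment (D := D) c 0 t (Nat.zero_le _) (fun i _ hi => hadj i (by omega))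
    (fun i j _ hij hj => hinj i j hij (by omega))
  have hP := HasPath.of_fun_segment (D := D) c t n htn.le (fun i _ hi => hadj i (by omega))
    (fun i j hi hij hj h => by
      rcases hj.lt_or_eq with hj | rfl
      · exact hinj i j hij hj h
      · rw [hn] at h
        exact hinj 0 i (by omega) hij h.symm)
  rw [hn] at hP
  refine ContainsBispindle.of_hasPath' hk (by omega : 1 ≤ n - t) hm hlong
    (fun h => hinj 0 t (by omega) htn h.symm) hP hQ (hR.mono subset_rfl (by omega)) ?_ ?_ ?_
  · rintro v ⟨s, hs1, hs2, rfl⟩ hv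
    rcases hs2.lt_or_eq with hs | rfl
    · rcases hY s hs hv with rfl | rfl <;> simp
    · exact Or.inr hn
  · rintro v ⟨s, hs1, hs2, rfl⟩ ⟨s', hs1', hs2', h⟩
    rcases hs2.lt_or_eq with hs | rfl
    · rcases hs1.lt_or_eq with hs1 | rfl
      · exact absurd h.symm (hinj s' s (by omega) hs)
      · exact Or.inl rfl
    · exact Or.inr hn
  · rintro v hv ⟨s, hs1, hs2, rfl⟩
    rcases hY s (by omega) hv with rfl | rfl <;> simp

namespace EarSystem

variable {D : Digraph V} {L : ℕ} (E : EarSystem D L)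

/-- A path `A` from the root to `w`, indexed backwards, must come close to `w` soon before
it reaches `w`. -/
theorem exists_near_of_path {k : ℕ} (hk : 2 ≤ k) (hfree : ¬ D.ContainsBispindle k 1 k) {w : V}
    (hw : w ≠ E.root) (hco : k ≤ E.copos w) (A : ℕ → V) (M : ℕ) (hA0 : A 0 = w)
    (hAM : A M = E.root) (hadj : ∀ i < M, D.Adj (A (i + 1)) (A i))
    (hinj : ∀ i j, i < j → j ≤ M → A i ≠ A j)
    (havoid : ∀ i, 1 ≤ i → i ≤ M → ∀ e < k, A i ≠ E.nxt^[e] w) :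
    ∃ i, 1 ≤ i ∧ i < k ∧ i ≤ M ∧
      ((∃ j m, 1 ≤ j ∧ j < k ∧ m < k ∧ A i = E.nxt^[m] (E.par^[j] w)) ∨
        ∃ s b, s + b < k ∧ E.nxt^[s] (A i) = E.par^[b] w ∧ ∀ j, A i ≠ E.par^[j] w) := by
  classical
  obtain ⟨c, a, n, hca, han, hah, hnd, hc0, hcn, hcadj, hcinj, hcN, hcP, hfirst⟩ :=
    E.exists_cycle hw
  have hpw := E.pos_pos hw
  -- If `A` meets the cycle before `w`, its last segment after such a meeting is an ear ending in
  -- `w`. Otherwise an ear is made of an in-tree path leaving the cycle and the end of `A`.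
  by_cases hex : ∃ i, (1 ≤ i ∧ i ≤ M) ∧ ∃ t < n, A i = c t
  · obtain ⟨⟨hi1, hiM⟩, t, htn, hit⟩ := Nat.find_spec hex
    set i := Nat.find hex with hi
    have hkt : k ≤ t := by
      by_contra! h
      rw [hcN t (by omega)] at hit
      exact havoid i hi1 hiM t h hit
    have hQ := HasPath.of_fun_reverse (D := D) A 0 i (Nat.zero_le _)
      (fun s _ hs => hadj s (by omega)) (fun s s' _ hs hs' => hinj s s' hs (by omega))
    rw [hit, hA0, ← hc0] at hQ
    have hshort : ¬ (k ≤ n - t ∨ k ≤ i - 0) := by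
      intro h
      refine hfree (.of_cycle_of_ear hk hcadj hcinj (hcn.trans hc0.symm) hkt htn hQ (by omega) h ?_)
      rintro s hs ⟨i', -, hi', h'⟩
      rcases Nat.eq_zero_or_pos i' with rfl | hpos
      · rw [hA0, ← hc0] at h'
        right
        by_contra hne
        exact hcinj 0 s (Nat.pos_of_ne_zero hne) hs h'.symm
      · have : i ≤ i' := Nat.find_min' hex ⟨⟨hpos, by omega⟩, s, hs, h'.symm⟩
        obtain rfl : i' = i := by omega
        rw [hit] at h'
        left
        by_contra hne
        rcases Nat.lt_or_gt_of_ne hne with hlt | hlt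
        · exact hcinj s t hlt htn h'
        · exact hcinj t s hlt hs h'.symm
    refine ⟨i, hi1, by omega, hiM, ?_⟩
    rcases le_or_gt a t with hat | hta
    · left
      exact ⟨n - t, 0, by omega, by omega, by omega, by rw [hit, hcP t hat htn.le]; rfl⟩
    · right
      -- From `c t` the in-tree needs `a - t` steps to the turning point of the cycle, which is `n -
      -- a` out-tree steps above `w`; together `n - t < k`.
      refine ⟨a - t, n - a, by omega, ?_, ?_⟩
      · rw [hit, hcN t hta.le, ← Function.iterate_add_apply, Nat.sub_add_cancel hta.le,
          ← hcN a le_rfl, hcP a le_rfl (by omega)]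
      · intro j
        rw [hit, hcN t hta.le]
        exact hfirst t j (by omega) hta
  · push Not at hex
    have hM : 1 ≤ M := by
      by_contra! h
      obtain rfl : M = 0 := by omega
      exact hw (hA0.symm.trans hAM)
    -- The ear starts at the last vertex of the in-tree path from `w` that lies on the cycle; from
    -- there on this path avoids the cycle.
    let p : ℕ → Prop := fun m => ∃ t < n, E.nxt^[m] w = c t
    have hpa : p a := ⟨a, by omega, (hcN a le_rfl).symm⟩
    have hspec : p (Nat.findGreatest p (E.height w)) := Nat.findGreatest_spec hah hpa
    have hmh : Nat.findGreatest p (E.height w) ≤ E.height w := Nat.findGreatest_le _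
    have ham : a ≤ Nat.findGreatest p (E.height w) := Nat.le_findGreatest hah hpa
    have hmax : ∀ m', m' ≤ E.height w → p m' → m' ≤ Nat.findGreatest p (E.height w) :=
      fun m' h h' => Nat.le_findGreatest h h'
    generalize Nat.findGreatest p (E.height w) = m at hspec hmh ham hmax
    obtain ⟨t, htn, hmt⟩ := hspec
    have hat : a ≤ t := by
      by_contra! h
      rw [hcN t h.le] at hmt
      have : m = t := E.reverse.par_iterate_inj hmh (h.le.trans hah) hmt
      omega
    have hη := hcP t hat htn.le
    have hη' : E.nxt^[m] w = E.par^[n - t] w := hmt.trans hη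
    set η := E.par^[n - t] w with hηdef
    have hiter : ∀ s, E.nxt^[s] η = E.nxt^[m + s] w := by
      intro s
      rw [← hη', ← Function.iterate_add_apply, add_comm]
    have hheight : E.height η = E.height w - m := by
      rw [← hη']; exact E.reverse.depth_iterate w m
    -- The root is on `A`, so the in-tree path from `η` meets `A`; the ear switches to `A` at the
    -- first meeting.
    have hsex : ∃ s, ∃ i, (1 ≤ i ∧ i ≤ M) ∧ E.nxt^[s] η = A i :=
      ⟨E.height η, M, ⟨hM, le_rfl⟩, by
        rw [hAM]; exact E.reverse.par_iterate_eq_root_iff.2 le_rfl⟩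
    have hsle : Nat.find hsex ≤ E.height η := Nat.find_min' hsex ⟨M, ⟨hM, le_rfl⟩, by
        rw [hAM]; exact E.reverse.par_iterate_eq_root_iff.2 le_rfl⟩
    obtain ⟨i, ⟨hi1, hiM⟩, hsi⟩ := Nat.find_spec hsex
    have hsmin : ∀ s' i', 1 ≤ i' → i' ≤ M → E.nxt^[s'] η = A i' → Nat.find hsex ≤ s' :=
      fun s' i' h1 h2 h3 => Nat.find_min' hsex ⟨i', ⟨h1, h2⟩, h3⟩
    generalize Nat.find hsex = s at hsle hsi hsmin
    have hs1 : 1 ≤ s := by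
      by_contra! h
      obtain rfl : s = 0 := by omega
      exact hex i ⟨hi1, hiM⟩ t htn (by rw [← hsi, hη]; rfl)
    have hΘ := HasPath.of_fun_segment (D := D) (fun s => E.nxt^[s] η) 0 s (Nat.zero_le _)
      (fun s' _ hs' => by
        rw [Function.iterate_succ_apply']
        refine E.adj_nxt _ fun hr => ?_
        have := E.reverse.par_iterate_eq_root_iff.1 hr
        change E.height η ≤ s' at this
        omega)
      (fun s' s'' _ h1 h2 h => h1.ne (E.reverse.par_iterate_inj (v := η)
        (by change s' ≤ E.height η; omega) (by change s'' ≤ E.height η; omega) h))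
    have hQ := HasPath.of_fun_reverse (D := D) A 0 i (Nat.zero_le _)
      (fun s _ hs => hadj s (by omega)) (fun s s' _ hs hs' => hinj s s' hs (by omega))
    simp only [hsi] at hΘ
    have hΘQ := hΘ.trans hQ (by
      rintro v ⟨s', -, hs', hv⟩ ⟨i', -, hi', rfl⟩
      rcases Nat.eq_zero_or_pos i' with rfl | hpos
      · exfalso
        rw [hA0, hiter] at hv
        exact E.nxt_iterate_ne_self hw (by omega) hv.symm
      · have := hsmin s' i' hpos (by omega) hv.symm
        obtain rfl : s' = s := by omega
        rw [hv, hsi])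
    rw [hA0, ← hc0, show E.nxt^[0] η = c t from hη.symm] at hΘQ
    have hshort : ¬ (k ≤ n - t ∨ k ≤ s - 0 + (i - 0)) := by
      intro h
      refine hfree (.of_cycle_of_ear hk hcadj hcinj (hcn.trans hc0.symm) (by omega) htn hΘQ
        (by omega) h ?_)
      rintro s₁ hs₁ (⟨s', -, hs', h'⟩ | ⟨i', -, hi', h'⟩)
      · rcases Nat.eq_zero_or_pos s' with rfl | hpos
        · left
          have h'' : c s₁ = c t := h'.trans hη.symm
          by_contra hne
          rcases Nat.lt_or_gt_of_ne hne with hlt | hlt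
          · exact hcinj s₁ t hlt htn h''
          · exact hcinj t s₁ hlt hs₁ h''.symm
        · exfalso
          have := hmax (m + s') (by omega) ⟨s₁, hs₁, by rw [← hiter, h']⟩
          omega
      · rcases Nat.eq_zero_or_pos i' with rfl | hpos
        · right
          rw [hA0, ← hc0] at h'
          by_contra hne
          exact hcinj 0 s₁ (Nat.pos_of_ne_zero hne) hs₁ h'.symm
        · exact absurd h'.symm (hex i' ⟨hpos, by omega⟩ s₁ hs₁)
    refine ⟨i, hi1, by omega, hiM, Or.inl ⟨n - t, s, by omega, by omega, by omega, ?_⟩⟩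
    rw [← hηdef, hsi]

/-- `exists_near_of_path` for a path that goes from the root to `v 0` in the out-tree and then
through `v 1, …, v N`. -/
theorem exists_near_of_chain {k : ℕ} (hk : 2 ≤ k) (hfree : ¬ D.ContainsBispindle k 1 k)
    (v : ℕ → V) (N : ℕ) (hN : 1 ≤ N) (hw : v N ≠ E.root) (hco : k ≤ E.copos (v N))
    (hadj : ∀ i < N, D.Adj (v i) (v (i + 1))) (hinj : ∀ i j, i < j → j ≤ N → v i ≠ v j)
    (hanc : ∀ i t, 1 ≤ t → t ≤ N → E.par^[i] (v 0) ≠ v t)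
    (havoid : ∀ t < N, ∀ e < k, v t ≠ E.nxt^[e] (v N))
    (havoid' : ∀ i, ∀ e < k, E.par^[i] (v 0) ≠ E.nxt^[e] (v N)) :
    ∃ x, ((∃ t, t < N ∧ N < t + k ∧ x = v t) ∨ ∃ i, N + i < k ∧ x = E.par^[i] (v 0)) ∧
      ((∃ j m, 1 ≤ j ∧ j < k ∧ m < k ∧ x = E.nxt^[m] (E.par^[j] (v N))) ∨
        ∃ s b, s + b < k ∧ E.nxt^[s] x = E.par^[b] (v N) ∧ ∀ j, x ≠ E.par^[j] (v N)) := by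
  -- `A` is indexed backwards: from `v N` to `v 0`, then up the out-tree to the root.
  let A : ℕ → V := fun i => if i < N then v (N - i) else E.par^[i - N] (v 0)
  have hA1 : ∀ i, i ≤ N → A i = v (N - i) := by
    intro i hi
    rcases hi.lt_or_eq with h | rfl
    · exact if_pos h
    · simp [A]
  have hA2 : ∀ i, N ≤ i → A i = E.par^[i - N] (v 0) := fun i hi => if_neg (by omega)
  obtain ⟨i, hi1, hik, hiM, h⟩ := E.exists_near_of_path hk hfree hw hco A (N + E.depth (v 0))
    (by rw [hA1 0 (by omega)]; rfl)
    (by rw [hA2 _ (by omega)]; exact E.par_iterate_eq_root_iff.2 (by omega))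
    (by
      intro i hi
      rcases lt_or_ge i N with h | h
      · rw [hA1 i h.le, hA1 (i + 1) h]
        have := hadj (N - (i + 1)) (by omega)
        rwa [show N - (i + 1) + 1 = N - i by omega] at this
      · rw [hA2 i h, hA2 (i + 1) (by omega), show i + 1 - N = i - N + 1 by omega,
          Function.iterate_succ_apply']
        refine E.adj_par _ fun hr => ?_
        have := E.par_iterate_eq_root_iff.1 hr
        omega)
    (by
      intro i j hij hj
      rcases lt_or_ge j N with h | h
      · rw [hA1 i (by omega), hA1 j h.le]
        exact (hinj _ _ (by omega) (by omega)).symm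
      · rw [hA2 j h]
        rcases lt_or_ge i N with h' | h'
        · rw [hA1 i h'.le]
          exact (hanc _ _ (by omega) (by omega)).symm
        · rw [hA2 i h']
          intro he
          have := E.par_iterate_inj (by omega) (by omega) he
          omega)
    (by
      intro i hi hiM e he
      rcases lt_or_ge i N with h | h
      · rw [hA1 i h.le]
        exact havoid _ (by omega) e he
      · rw [hA2 i h]
        exact havoid' _ e he)
  refine ⟨A i, ?_, h⟩
  rcases lt_or_ge i N with h | h
  · exact Or.inl ⟨N - i, by omega, by omega, hA1 i h.le⟩
  · exact Or.inr ⟨i - N, by omega, hA2 i h⟩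

end EarSystem

/-! ### Two general colouring principles -/

/-- A colouring chosen greedily, in the order of `time`. -/
theorem exists_greedy_coloring [Finite V] (time : V → ℕ) (F : V → Finset V) (N : ℕ)
    (hF : ∀ v, (F v).card < N) :
    ∃ c : V → Fin N, ∀ v, ∀ u ∈ F v, time u < time v → c u ≠ c v := by
  classical
  obtain ⟨n, hn⟩ : ∃ n, ∀ v, time v < n := by
    obtain ⟨n, hn⟩ := (Set.finite_range time).bddAbove
    exact ⟨n + 1, fun v => Nat.lt_succ_of_le (hn ⟨v, rfl⟩)⟩
  suffices h : ∀ n, ∃ c : V → Fin N, ∀ v, time v < n → ∀ u ∈ F v, time u < time v → c u ≠ c v by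
    obtain ⟨c, hc⟩ := h n
    exact ⟨c, fun v => hc v (hn v)⟩
  intro n
  induction n with
  | zero =>
    refine ⟨fun v => ⟨0, (Nat.zero_le _).trans_lt (hF v)⟩, fun v hv => absurd hv (Nat.not_lt_zero _)⟩
  | succ n ih =>
    obtain ⟨c, hc⟩ := ih
    have hfree : ∀ v, ∃ x : Fin N, x ∉ (F v).image c := by
      intro v
      by_contra! h
      have h1 : (Finset.univ : Finset (Fin N)) ⊆ (F v).image c := fun x _ => h x
      have h2 := Finset.card_le_card h1
      have h3 := Finset.card_image_le (s := F v) (f := c)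
      have h4 := hF v
      simp only [Finset.card_univ, Fintype.card_fin] at h2
      omega
    choose x hx using hfree
    -- Only the vertices of time `n` are recoloured. They put no condition on each other, since
    -- conditions compare strictly different times.
    refine ⟨fun v => if time v = n then x v else c v, fun v hv u hu huv => ?_⟩
    dsimp only
    rw [if_neg (by omega : time u ≠ n)]
    split_ifs with h
    · intro he
      exact hx v (he ▸ Finset.mem_image_of_mem c hu)
    · exact hc v (by omega) u hu huv

/-- A relation without chains of `k` steps is properly coloured by the lengths of its longest
chains. -/
theorem exists_rank_coloring (R : V → V → Prop) (k : ℕ) (hk : 1 ≤ k)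
    (hR : ∀ v : ℕ → V, ¬ ∀ i < k, R (v i) (v (i + 1))) :
    ∃ f : V → Fin k, ∀ u v, R u v → f u ≠ f v := by
  classical
  let p : V → ℕ → Prop := fun v n => ∃ s : ℕ → V, s n = v ∧ ∀ i < n, R (s i) (s (i + 1))
  -- The length of a longest chain ending in `v`, capped at `k - 1`. The cap loses nothing, as
  -- chains of `k` steps are excluded.
  let g : V → ℕ := fun v => Nat.findGreatest (p v) (k - 1)
  have hg : ∀ v, g v ≤ k - 1 := fun v => Nat.findGreatest_le _
  refine ⟨fun v => ⟨g v, by have := hg v; omega⟩, fun u v huv he => ?_⟩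
  have he' : g u = g v := by simpa using he
  have hu : p u (g u) := by
    refine Nat.findGreatest_spec (m := 0) (Nat.zero_le _) ⟨fun _ => u, rfl, fun i hi => ?_⟩
    exact absurd hi (Nat.not_lt_zero _)
  obtain ⟨s, hs, hchain⟩ := hu
  have hext : ∀ i < g u + 1, R (if i ≤ g u then s i else v) (if i + 1 ≤ g u then s (i + 1) else v) := by
    intro i hi
    rw [if_pos (by omega)]
    split_ifs with h
    · exact hchain i (by omega)
    · obtain rfl : i = g u := by omega
      rwa [hs]
  have hp : p v (g u + 1) := ⟨fun i => if i ≤ g u then s i else v, by simp, hext⟩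
  rcases Nat.lt_or_ge (g u + 1) k with h | h
  · have : g u + 1 ≤ g v := Nat.le_findGreatest (by omega) hp
    omega
  · obtain h' : g u + 1 = k := by have := hg u; omega
    exact hR (fun i => if i ≤ g u then s i else v) (fun i hi => hext i (by omega))

theorem lt_of_forall_lt_succ {g : ℕ → ℕ} {n : ℕ} (h : ∀ i < n, g i < g (i + 1)) :
    ∀ i j, i < j → j ≤ n → g i < g j := by
  intro i j hij hj
  induction j with
  | zero => omega
  | succ j ih =>
    have := h j (by omega)
    rcases Nat.lt_or_ge i j with h' | h'
    · have := ih h' (by omega)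
      omega
    · obtain rfl : i = j := by omega
      exact this

theorem gt_of_forall_gt_succ {g : ℕ → ℕ} {n : ℕ} (h : ∀ i < n, g (i + 1) < g i) :
    ∀ i j, i < j → j ≤ n → g j < g i := by
  intro i j hij hj
  induction j with
  | zero => omega
  | succ j ih =>
    have := h j (by omega)
    rcases Nat.lt_or_ge i j with h' | h'
    · have := ih h' (by omega)
      omega
    · obtain rfl : i = j := by omega
      exact this

theorem forall_eq_of_forall_eq_succ {α : Type*} {g : ℕ → α} {n : ℕ}
    (h : ∀ i < n, g i = g (i + 1)) : ∀ i ≤ n, g i = g 0 := by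
  intro i hi
  induction i with
  | zero => rfl
  | succ i ih => rw [← h i (by omega), ih (by omega)]

/-! ### Arcs at vertices far from both ends of their ear -/

namespace EarSystem

variable {D : Digraph V} {L : ℕ} (E : EarSystem D L)

/-- The out-tree path to `v` followed by the arc `v u` stays in earlier ears until `u`. A vertex
tied to `u` as in `exists_near_of_chain` cannot do so: fewer than `k` steps from `u` in the trees do
not leave its ear. -/
theorem not_adj_of_time_lt {k : ℕ} (hk : 2 ≤ k) (hfree : ¬ D.ContainsBispindle k 1 k) {u v : V}
    (huv : E.time v < E.time u) (hp : k ≤ E.pos u) (hc : k ≤ E.copos u) : ¬ D.Adj v u := by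
  intro hadj
  have hu : u ≠ E.root := E.ne_root_of_time (by omega)
  have htp : ∀ j < k, E.time (E.par^[j] u) = E.time u := fun j hj =>
    (E.par_iterate_of_lt_pos hu (by omega)).1
  have hv : ∀ i, E.time (E.par^[i] v) < E.time u := fun i => (E.time_par_iterate_le v i).trans_lt huv
  have htn : ∀ e < k, E.time (E.nxt^[e] u) = E.time u := fun e he =>
    (E.nxt_iterate_of_lt_copos hu (by omega)).1
  obtain ⟨x, hx, h⟩ := E.exists_near_of_chain hk hfree (fun i => if i = 0 then v else u) 1 le_rfl
    (by simpa) (by simpa) (by intro i hi; obtain rfl : i = 0 := by omega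
                              simpa)
    (by intro i j hij hj; obtain ⟨rfl, rfl⟩ : i = 0 ∧ j = 1 := by omega
        intro h; rw [show v = u by simpa using h] at huv; omega)
    (by intro i t h1 h2 h; obtain rfl : t = 1 := by omega
        have := hv i; rw [show E.par^[i] v = u by simpa using h] at this; omega)
    (by intro t ht e he h; obtain rfl : t = 0 := by omega
        have h' : v = E.nxt^[e] u := by simpa using h
        have := htn e he; rw [← h'] at this; omega)
    (by intro i e he h
        have h' : E.par^[i] v = E.nxt^[e] u := by simpa using h
        have := htn e he; rw [← h'] at this; have := hv i; omega)
  have hxu : E.time x < E.time u := by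
    rcases hx with ⟨t, ht, -, rfl⟩ | ⟨i, -, rfl⟩
    · obtain rfl : t = 0 := by omega
      simpa using huv
    · simpa using hv i
  simp only [one_ne_zero, if_false] at h
  rcases h with ⟨j, m, -, hj, hm, rfl⟩ | ⟨s, b, hsb, hxb, -⟩
  · obtain ⟨h1, -, h3, -⟩ := E.par_iterate_of_lt_pos hu (i := j) (by omega)
    have hr : E.par^[j] u ≠ E.root := E.ne_root_of_time (by omega)
    have := (E.nxt_iterate_of_lt_copos hr (i := m) (by omega)).1
    omega
  · have h1 := htp b (by omega)
    have h2 := E.time_nxt_iterate_le x s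
    rw [hxb] at h2
    omega

theorem eq_par_iterate_of_time_eq {u v : V} (ht : E.time u = E.time v) (hp : E.pos u ≤ E.pos v)
    (hv : v ≠ E.root) : u = E.par^[E.pos v - E.pos u] v := by
  have hu : u ≠ E.root := E.ne_root_of_time (ht ▸ E.time_pos v hv)
  have := E.pos_pos hu
  obtain ⟨h1, h2, -, -⟩ := E.par_iterate_of_lt_pos hv (i := E.pos v - E.pos u) (by omega)
  exact E.pos_inj _ _ (by omega) (by omega)

/-- All vertices before `v` on the path through the chord are out-tree ancestors of `v`. For a long
chord they are at least `k` steps above `v`, too far for the first alternative of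
`exists_near_of_chain`; the second alternative excludes ancestors. -/
theorem forward_chord_lt {k : ℕ} (hk : 2 ≤ k) (hfree : ¬ D.ContainsBispindle k 1 k) {u v : V}
    (hv : v ≠ E.root) (ht : E.time u = E.time v) (hp : E.pos u < E.pos v)
    (hpv : k ≤ E.pos v) (hcv : k ≤ E.copos v) (hadj : D.Adj u v) : E.pos v < E.pos u + k := by
  by_contra! hd
  have hu := E.eq_par_iterate_of_time_eq ht hp.le hv
  have hpar : ∀ i, E.par^[i] u = E.par^[i + (E.pos v - E.pos u)] v := by
    intro i
    rw [Function.iterate_add_apply, ← hu]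
  generalize E.pos v - E.pos u = d at hu hpar
  have hav : ∀ i, ∀ e < k, E.par^[i] u ≠ E.nxt^[e] v := by
    intro i e he h
    have h4 := (E.nxt_iterate_of_lt_copos hv (i := e) (by omega)).2.2.2
    rw [← h, hpar, ← Function.iterate_add_apply] at h4
    by_cases h0 : e + (i + d) = 0
    · obtain rfl : d = 0 := by omega
      rw [show u = v from hu] at hp
      omega
    · exact E.par_iterate_ne_self hv (by omega) h4
  have huv : ∀ i, E.par^[i] u ≠ v := fun i h => hav i 0 (by omega) h
  obtain ⟨x, hx, h⟩ := E.exists_near_of_chain hk hfree (fun i => if i = 0 then u else v) 1 le_rfl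
    (by simpa) (by simpa) (by intro i hi; obtain rfl : i = 0 := by omega
                              simpa)
    (by intro i j hij hj; obtain ⟨rfl, rfl⟩ : i = 0 ∧ j = 1 := by omega
        simpa using huv 0)
    (by intro i t h1 h2; obtain rfl : t = 1 := by omega
        simpa using huv i)
    (by intro t ht; obtain rfl : t = 0 := by omega
        simpa using hav 0)
    (by simpa using hav)
  obtain ⟨i, rfl⟩ : ∃ i, x = E.par^[i] u := by
    rcases hx with ⟨t, ht, -, rfl⟩ | ⟨i, -, rfl⟩
    · obtain rfl : t = 0 := by omega
      exact ⟨0, by simp⟩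
    · exact ⟨i, by simp⟩
  simp only [one_ne_zero, if_false] at h
  have hdk : k ≤ d := by
    by_contra! h'
    have := (E.par_iterate_of_lt_pos hv (i := d) (by omega)).2.1
    rw [← hu] at this
    omega
  rcases h with ⟨j, m, hj1, hj, hm, h⟩ | ⟨s, b, hsb, hxb, h⟩
  · obtain ⟨h1, -, h3, -⟩ := E.par_iterate_of_lt_pos hv (i := j) (by omega)
    have hr : E.par^[j] v ≠ E.root := E.ne_root_of_time (by have := E.time_pos v hv; omega)
    have h4 := (E.nxt_iterate_of_lt_copos hr (i := m) (by omega)).2.2.2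
    rw [← h, hpar, ← Function.iterate_add_apply] at h4
    have := E.eq_of_par_iterate_eq h4.symm hr
    omega
  · exact h _ (hpar i)

/-- The cycle through `v` runs along the ear past `u`, so the chord is an ear of length one on it.
If the chord is long, both arcs of the cycle between `u` and `v` have length at least `k`. -/
theorem backward_chord_lt {k : ℕ} (hk : 2 ≤ k) (hfree : ¬ D.ContainsBispindle k 1 k) {u v : V}
    (hv : v ≠ E.root) (ht : E.time u = E.time v) (hp : E.pos v < E.pos u)
    (hcv : k ≤ E.copos u) (hadj : D.Adj u v) : E.pos u < E.pos v + k := by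
  by_contra! hd
  have hu : u ≠ E.root := E.ne_root_of_time (ht ▸ E.time_pos v hv)
  have hpv := E.pos_pos hv
  have hvu := E.eq_par_iterate_of_time_eq ht.symm hp.le hu
  have hdp : E.pos u - E.pos v < E.pos u := by omega
  have hdk : k ≤ E.pos u - E.pos v := by omega
  have hd1 : 1 ≤ E.pos u - E.pos v := by omega
  generalize E.pos u - E.pos v = d at *
  obtain ⟨-, -, h3, h4⟩ := E.par_iterate_of_lt_pos hu hdp
  rw [← hvu] at h3 h4
  obtain ⟨c, a, n, hca, han, hah, hnd, hc0, hcn, hcadj, hcinj, hcN, hcP, hfirst⟩ :=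
    E.exists_cycle hv
  have hne : u ≠ v := fun h => by rw [h] at hp; omega
  have hcd : c d = u := by rw [hcN d (by omega), h4]
  have hQ := HasPath.arc hne hadj
  rw [← hcd, ← hc0] at hQ
  refine hfree (.of_cycle_of_ear hk hcadj hcinj (hcn.trans hc0.symm) hdk (by omega) hQ le_rfl
    (Or.inl (by omega)) ?_)
  rintro s hs (h | h)
  · left
    by_contra hne
    rcases Nat.lt_or_gt_of_ne hne with hlt | hlt
    · exact hcinj s d hlt (by omega) h
    · exact hcinj d s hlt hs h.symm
  · right
    by_contra hne
    exact hcinj 0 s (Nat.pos_of_ne_zero hne) hs h.symm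

end EarSystem

/-! ### Colouring the vertices near the start of their ear -/

/-- A bound for the chromatic number of a digraph with an ear decomposition. -/
def earSystemBound (k : ℕ) : ℕ := 1 + k + 2 * (2 * k ^ 5)

namespace EarSystem

variable {D : Digraph V} {L : ℕ} (E : EarSystem D L)

/-- Two vertices above `w` in the out-tree, at distance at least `k` from `w` and from each other,
cannot both be reached from `w` by paths avoiding the out-tree path to `w`. -/
theorem false_of_two_paths_to_ancestors {k : ℕ} (hk : 2 ≤ k) (hfree : ¬ D.ContainsBispindle k 1 k)
    {w : V} {p q : ℕ → V} {n m i₁ i₂ : ℕ} (hi₁ : k ≤ i₁) (hi₂ : i₁ + k ≤ i₂) (hd : i₂ ≤ E.depth w)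
    (hn : 1 ≤ n) (hp0 : p 0 = w) (hq0 : q 0 = w)
    (hpn : p n = E.par^[i₁] w) (hqm : q m = E.par^[i₂] w)
    (hpadj : ∀ i < n, D.Adj (p i) (p (i + 1))) (hqadj : ∀ i < m, D.Adj (q i) (q (i + 1)))
    (hpinj : ∀ i j, i < j → j ≤ n → p i ≠ p j) (hqinj : ∀ i j, i < j → j ≤ m → q i ≠ q j)
    (hpanc : ∀ t, 0 < t → t < n → ∀ i, E.par^[i] w ≠ p t)
    (hqanc : ∀ t, 0 < t → t < m → ∀ i, E.par^[i] w ≠ q t) : False := by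
  classical
  have hTinj : ∀ i j, i < j → j ≤ i₂ → E.par^[i] w ≠ E.par^[j] w := fun i j hij hj h =>
    hij.ne (E.par_iterate_inj (by omega) (by omega) h)
  have hTadj : ∀ i < i₂, D.Adj (E.par^[i + 1] w) (E.par^[i] w) := by
    intro i hi
    rw [Function.iterate_succ_apply']
    refine E.adj_par _ fun hr => ?_
    have := E.par_iterate_eq_root_iff.1 hr
    omega
  have hT0 : ∀ i, 0 < i → i ≤ i₂ → w ≠ E.par^[i] w := fun i hi hi' => hTinj 0 i hi hi'
  have hm : 1 ≤ m := by
    by_contra! h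
    obtain rfl : m = 0 := by omega
    exact hT0 i₂ (by omega) le_rfl (hq0.symm.trans hqm)
  have hqeq : ∀ i j, i ≤ m → j ≤ m → q i = q j → i = j := by
    intro i j hi hj h
    by_contra hne
    rcases Nat.lt_or_gt_of_ne hne with hlt | hlt
    · exact hqinj i j hlt hj h
    · exact hqinj j i hlt hi h.symm
  have hpeq : ∀ i j, i ≤ n → j ≤ n → p i = p j → i = j := by
    intro i j hi hj h
    by_contra hne
    rcases Nat.lt_or_gt_of_ne hne with hlt | hlt
    · exact hpinj i j hlt hj h
    · exact hpinj j i hlt hi h.symm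
  have hTeq : ∀ i j, i ≤ i₂ → j ≤ i₂ → E.par^[i] w = E.par^[j] w → i = j := fun i j hi hj h =>
    E.par_iterate_inj (by omega) (by omega) h
  have hqT : ∀ j i, j ≤ m → i ≤ i₂ → q j = E.par^[i] w → (j = 0 ∧ i = 0) ∨ (j = m ∧ i = i₂) := by
    intro j i hj hi h
    rcases Nat.eq_zero_or_pos j with rfl | h0
    · rw [hq0] at h
      exact Or.inl ⟨rfl, (hTeq 0 i (by omega) hi h).symm⟩
    · rcases hj.lt_or_eq with hj | rfl
      · exact absurd h.symm (hqanc j h0 hj i)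
      · rw [hqm] at h
        exact Or.inr ⟨rfl, hTeq _ _ hi le_rfl h.symm⟩
  have hpT : ∀ j i, j ≤ n → i ≤ i₂ → p j = E.par^[i] w → (j = 0 ∧ i = 0) ∨ (j = n ∧ i = i₁) := by
    intro j i hj hi h
    rcases Nat.eq_zero_or_pos j with rfl | h0
    · rw [hp0] at h
      exact Or.inl ⟨rfl, (hTeq 0 i (by omega) hi h).symm⟩
    · rcases hj.lt_or_eq with hj | rfl
      · exact absurd h.symm (hpanc j h0 hj i)
      · rw [hpn] at h
        exact Or.inr ⟨rfl, hTeq _ _ hi (by omega) h.symm⟩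
  -- The branch vertices are the last vertex of `p`, before its end, that lies on `q`, and the
  -- ancestor `par^[i₁] w`. Between them run the end of `p`, and the end of `q` prolonged down the
  -- out-tree from `par^[i₂] w`; the way back is the out-tree path to `w` followed by the start of
  -- `q`.
  let P : ℕ → Prop := fun t => ∃ j < m, p t = q j
  have hP0 : P 0 := ⟨0, by omega, hp0.trans hq0.symm⟩
  have hspec : P (Nat.findGreatest P (n - 1)) := Nat.findGreatest_spec (Nat.zero_le _) hP0
  have ht₀ : Nat.findGreatest P (n - 1) ≤ n - 1 := Nat.findGreatest_le _
  have hmax : ∀ t, t ≤ n - 1 → P t → t ≤ Nat.findGreatest P (n - 1) :=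
    fun t h h' => Nat.le_findGreatest h h'
  generalize Nat.findGreatest P (n - 1) = t₀ at hspec ht₀ hmax
  obtain ⟨j₀, hj₀, hs⟩ := hspec
  have hpq : ∀ t j, t₀ ≤ t → t ≤ n → j ≤ m → p t = q j → t = t₀ ∧ j = j₀ := by
    intro t j h1 h2 h3 h
    rcases h3.lt_or_eq with h3 | rfl
    · rcases h2.lt_or_eq with h2 | rfl
      · have := hmax t (by omega) ⟨j, h3, h⟩
        obtain rfl : t = t₀ := by omega
        exact ⟨rfl, hqeq _ _ h3.le hj₀.le (h.symm.trans hs)⟩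
      · rw [hpn] at h
        rcases hqT j i₁ h3.le (by omega) h.symm with h | h <;> omega
    · rw [hqm] at h
      rcases hpT t i₂ h2 le_rfl h with h | h <;> omega
  have hQ := HasPath.of_fun_segment (D := D) p t₀ n (by omega) (fun i _ hi => hpadj i hi)
    (fun i j _ hij hj => hpinj i j hij hj)
  have hP1 := HasPath.of_fun_segment (D := D) q j₀ m hj₀.le (fun i _ hi => hqadj i hi)
    (fun i j _ hij hj => hqinj i j hij hj)
  have hP2 := HasPath.of_fun_reverse (D := D) (fun i => E.par^[i] w) i₁ i₂ (by omega)
    (fun i _ hi => hTadj i hi) (fun i j _ hij hj => hTinj i j hij hj)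
  have hR1 := HasPath.of_fun_reverse (D := D) (fun i => E.par^[i] w) 0 i₁ (by omega)
    (fun i _ hi => hTadj i (by omega)) (fun i j _ hij hj => hTinj i j hij (by omega))
  have hR2 := HasPath.of_fun_segment (D := D) q 0 j₀ (Nat.zero_le _) (fun i _ hi => hqadj i (by omega))
    (fun i j _ hij hj => hqinj i j hij (by omega))
  rw [hqm] at hP1
  rw [hq0] at hR2
  have hP := hP1.trans hP2 (by
    rintro v ⟨j, hj1, hj2, rfl⟩ ⟨i, hi1, hi2, h⟩
    rcases hqT j i hj2 hi2 h with ⟨rfl, rfl⟩ | ⟨rfl, rfl⟩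
    · omega
    · exact hqm)
  have hR := hR1.trans hR2 (by
    rintro v ⟨i, hi1, hi2, rfl⟩ ⟨j, hj1, hj2, h⟩
    rcases hqT j i (by omega) (by omega) h.symm with ⟨rfl, rfl⟩ | ⟨rfl, rfl⟩
    · rfl
    · omega)
  rw [hs, hpn] at hQ
  refine hfree (.of_hasPath hk ?_ (hP.mono subset_rfl (by omega)) (hQ.mono subset_rfl (by omega))
    (hR.mono subset_rfl (by omega)) ?_ ?_ ?_)
  · intro h
    rcases hqT j₀ i₁ hj₀.le (by omega) h with h | h <;> omega
  · rintro v (⟨j, hj1, hj2, rfl⟩ | ⟨i, hi1, hi2, rfl⟩) ⟨t, ht1, ht2, h⟩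
    · obtain ⟨rfl, rfl⟩ := hpq t j ht1 ht2 hj2 h.symm
      exact Or.inl rfl
    · rcases hpT t i ht2 hi2 h.symm with ⟨rfl, rfl⟩ | ⟨rfl, rfl⟩
      · omega
      · exact Or.inr rfl
  · rintro v (⟨j, hj1, hj2, rfl⟩ | ⟨i, hi1, hi2, rfl⟩) (⟨i', hi1', hi2', h⟩ | ⟨j', hj1', hj2', h⟩)
    · rcases hqT j i' hj2 (by omega) h with ⟨rfl, rfl⟩ | ⟨rfl, rfl⟩
      · left; congr 1; omega
      · omega
    · obtain rfl := hqeq _ _ hj2 (by omega) h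
      left; congr 1; omega
    · have := hTeq _ _ hi2 (by omega) h
      obtain rfl : i = i₁ := by omega
      exact Or.inr rfl
    · rcases hqT j' i (by omega) hi2 h.symm with ⟨rfl, rfl⟩ | ⟨rfl, rfl⟩ <;> omega
  · rintro v ⟨t, ht1, ht2, rfl⟩ (⟨i', hi1', hi2', h⟩ | ⟨j', hj1', hj2', h⟩)
    · rcases hpT t i' ht2 (by omega) h with ⟨rfl, rfl⟩ | ⟨rfl, rfl⟩
      · left
        obtain rfl : t₀ = 0 := by omega
        exact hs
      · exact Or.inr hpn
    · obtain ⟨rfl, rfl⟩ := hpq t j' ht1 ht2 (by omega) h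
      exact Or.inl hs

/-- The vertices close to the beginning of their ear. -/
def IsHead (k : ℕ) (v : V) : Prop := v ≠ E.root ∧ E.pos v < k

/-- Two vertices in the same place of their ears that have the same colour. -/
def SameClass {α : Type*} (k : ℕ) (c : V → α) (u v : V) : Prop :=
  E.IsHead k u ∧ E.IsHead k v ∧ E.pos u = E.pos v ∧ c u = c v

/-- The colour of `v` differs from the colours of the earlier vertices that are reached from `v` by
fewer than `k` steps towards the root in the out-tree and fewer than `k` steps in the in-tree. -/
def IsLocalColoring {α : Type*} (k : ℕ) (c : V → α) : Prop :=
  ∀ v j m, 1 ≤ j → j < k → m < k → E.time (E.nxt^[m] (E.par^[j] v)) < E.time v →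
    c (E.nxt^[m] (E.par^[j] v)) ≠ c v

/-- Greedy: at most `(k - 1) * k` vertices, one for each pair `(j, m)`, are to be avoided. -/
theorem exists_isLocalColoring [Finite V] (k : ℕ) (hk : 1 ≤ k) :
    ∃ c : V → Fin (k * k), E.IsLocalColoring k c := by
  classical
  obtain ⟨c, hc⟩ := exists_greedy_coloring E.time
    (fun v => (Finset.Ico 1 k ×ˢ Finset.range k).image fun p => E.nxt^[p.2] (E.par^[p.1] v)) (k * k)
    (fun v => by
      refine Finset.card_image_le.trans_lt ?_
      rw [Finset.card_product, Nat.card_Ico, Finset.card_range]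
      exact Nat.mul_lt_mul_of_pos_right (by omega) (by omega))
  refine ⟨c, fun v j m h1 h2 h3 h => hc v _ ?_ h⟩
  exact Finset.mem_image.2 ⟨(j, m), by simp [h1, h2, h3], rfl⟩

variable {α : Type*} {k : ℕ} {c : V → α}

/-- A nearer ancestor in an earlier ear has another local colour, and one in the same ear has
another position. -/
theorem IsLocalColoring.le_of_sameClass {E : EarSystem D L} (hc : E.IsLocalColoring k c) {v : V}
    {d : ℕ} (h : E.SameClass k c (E.par^[d] v) v) (hne : E.par^[d] v ≠ v) : k ≤ d := by
  by_contra! hd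
  rcases (E.time_par_iterate_le v d).lt_or_eq with ht | ht
  · refine hc v d 0 ?_ hd (by omega) ht h.2.2.2
    by_contra! h0
    obtain rfl : d = 0 := by omega
    exact hne rfl
  · exact hne (E.pos_inj _ _ ht h.2.2.1)

theorem SameClass.trans {E : EarSystem D L} {u v w : V} (h : E.SameClass k c u v)
    (h' : E.SameClass k c v w) : E.SameClass k c u w :=
  ⟨h.1, h'.2.1, h.2.2.1.trans h'.2.2.1, h.2.2.2.trans h'.2.2.2⟩

theorem SameClass.symm {E : EarSystem D L} {u v : V} (h : E.SameClass k c u v) :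
    E.SameClass k c v u := ⟨h.2.1, h.1, h.2.2.1.symm, h.2.2.2.symm⟩

theorem sameClass_of_forall_succ {v : ℕ → V} {n : ℕ}
    (h : ∀ i < n, E.SameClass k c (v i) (v (i + 1))) :
    ∀ i j, i < j → j ≤ n → E.SameClass k c (v i) (v j) := by
  intro i j hij hj
  induction j with
  | zero => omega
  | succ j ih =>
    rcases Nat.lt_or_ge i j with h' | h'
    · exact (ih h' (by omega)).trans (h j (by omega))
    · obtain rfl : i = j := by omega
      exact h i (by omega)

/-- Arcs within a class that go to a later ear. -/
def Later (k : ℕ) (c : V → α) (u v : V) : Prop :=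
  D.Adj u v ∧ E.time u < E.time v ∧ E.SameClass k c u v

/-- Arcs within a class that go to an earlier ear. -/
def Earlier (k : ℕ) (c : V → α) (u v : V) : Prop :=
  D.Adj u v ∧ E.time v < E.time u ∧ E.SameClass k c u v

theorem IsHead.copos_ge {E : EarSystem D (2 * k)} {v : V} (h : E.IsHead k v) : k ≤ E.copos v := by
  have := E.length_le v h.1
  have := h.2
  omega

/-- Apply `exists_near_of_chain` with `w = v k`; as the chain has `k` steps, the vertex found is
some `v t` with `t < k`. The first alternative contradicts the local colouring. In the second, the
in-tree steps stay on the ear of `v t`, so `v t` is an ancestor of `w` after all. -/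
theorem no_later_chain {E : EarSystem D (2 * k)} (hk : 2 ≤ k) (hfree : ¬ D.ContainsBispindle k 1 k)
    (hc : E.IsLocalColoring k c) (v : ℕ → V) : ¬ ∀ i < k, E.Later k c (v i) (v (i + 1)) := by
  intro h
  have htime := lt_of_forall_lt_succ (g := fun i => E.time (v i)) fun i hi => (h i hi).2.1
  have hsame := E.sameClass_of_forall_succ fun i hi => (h i hi).2.2
  have hw : E.IsHead k (v k) := (hsame 0 k (by omega) le_rfl).2.1
  have htn : ∀ e < k, E.time (E.nxt^[e] (v k)) = E.time (v k) := fun e he =>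
    (E.nxt_iterate_of_lt_copos hw.1 (he.trans_le hw.copos_ge)).1
  have hpar : ∀ i, E.time (E.par^[i] (v 0)) ≤ E.time (v 0) := E.time_par_iterate_le _
  have ht0 : ∀ t, 1 ≤ t → t ≤ k → E.time (v 0) < E.time (v t) := fun t h1 h2 => htime 0 t h1 h2
  obtain ⟨x, hx, hx'⟩ := E.exists_near_of_chain hk hfree v k (by omega) hw.1 hw.copos_ge
    (fun i hi => (h i hi).1)
    (fun i j hij hj he => absurd (congrArg E.time he) (htime i j hij hj).ne)
    (fun i t h1 h2 he => by
      have := hpar i; have := ht0 t h1 h2; rw [he] at *; omega)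
    (fun t ht e he h => by
      have h1 := htn e he; have h2 : E.time (v t) < E.time (v k) := htime t k ht le_rfl
      rw [← h] at h1; omega)
    (fun i e he h => by
      have h1 := htn e he; have h2 := ht0 k (by omega) le_rfl; have h3 := hpar i
      rw [← h] at h1; omega)
  rcases hx with ⟨t, ht, -, rfl⟩ | ⟨i, hi, -⟩
  · have h2 : E.time (v t) < E.time (v k) := htime t k ht le_rfl
    rcases hx' with ⟨j, m, hj1, hj, hm, he⟩ | ⟨s, b, hsb, he, hn⟩
    · rw [he] at h2
      exact hc _ j m hj1 hj hm h2 (he ▸ (hsame t k ht le_rfl).2.2.2)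
    · have hvt := (hsame t k ht le_rfl).1
      have h4 := (E.nxt_iterate_of_lt_copos hvt.1
        (i := s) ((by omega : s < k).trans_le hvt.copos_ge)).2.2.2
      rw [he, ← Function.iterate_add_apply] at h4
      exact hn _ h4.symm
  · omega

/-- Here `v k` lies in the earliest ear of the chain. Tree steps from it never lead to a later ear,
while fewer than `k` in-tree steps from `v t` stay on the later ear of `v t`; so both alternatives
fail. The condition on ancestors of `v 0` makes the out-tree path to `v 0` and the chain together
one path. -/
theorem no_earlier_chain {E : EarSystem D (2 * k)} (hk : 2 ≤ k)
    (hfree : ¬ D.ContainsBispindle k 1 k) (v : ℕ → V)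
    (hanc : ∀ i t, 1 ≤ t → t ≤ k → E.par^[i] (v 0) ≠ v t) :
    ¬ ∀ i < k, E.Earlier k c (v i) (v (i + 1)) := by
  intro h
  have htime := gt_of_forall_gt_succ (g := fun i => E.time (v i)) fun i hi => (h i hi).2.1
  have hsame := E.sameClass_of_forall_succ fun i hi => (h i hi).2.2
  have hw : E.IsHead k (v k) := (hsame 0 k (by omega) le_rfl).2.1
  have htn : ∀ e < k, E.time (E.nxt^[e] (v k)) = E.time (v k) := fun e he =>
    (E.nxt_iterate_of_lt_copos hw.1 (he.trans_le hw.copos_ge)).1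
  obtain ⟨x, hx, hx'⟩ := E.exists_near_of_chain hk hfree v k (by omega) hw.1 hw.copos_ge
    (fun i hi => (h i hi).1)
    (fun i j hij hj he => absurd (congrArg E.time he) (htime i j hij hj).ne')
    hanc
    (fun t ht e he h => by
      have h1 := htn e he; have h2 : E.time (v k) < E.time (v t) := htime t k ht le_rfl
      rw [← h] at h1; omega)
    (fun i e he h => by
      have h4 := (E.nxt_iterate_of_lt_copos hw.1 (he.trans_le hw.copos_ge)).2.2.2
      rw [← h, ← Function.iterate_add_apply] at h4
      exact hanc _ k (by omega) le_rfl h4)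
  rcases hx with ⟨t, ht, -, rfl⟩ | ⟨i, hi, -⟩
  · have h2 : E.time (v k) < E.time (v t) := htime t k ht le_rfl
    rcases hx' with ⟨j, m, hj1, hj, hm, he⟩ | ⟨s, b, hsb, he, hn⟩
    · rw [he] at h2
      have h5 := E.time_nxt_iterate_le (E.par^[j] (v k)) m
      have h6 := E.time_par_iterate_le (v k) j
      omega
    · have hvt := (hsame t k ht le_rfl).1
      have h4 := (E.nxt_iterate_of_lt_copos hvt.1
        (i := s) ((by omega : s < k).trans_le hvt.copos_ge)).1
      have h6 := E.time_par_iterate_le (v k) b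
      rw [he] at h4
      omega
  · omega

/-- `u` lies above `w` in the out-tree and is reached from `w` by a chain of arcs within the class
going to earlier ears; no other vertex of the chain lies above `w`. -/
def ReturnsTo (k : ℕ) (c : V → α) (w u : V) : Prop :=
  ∃ (n : ℕ) (p : ℕ → V) (i : ℕ), 1 ≤ n ∧ p 0 = w ∧ p n = u ∧ u = E.par^[i] w ∧
    (∀ i < n, E.Earlier k c (p i) (p (i + 1))) ∧ ∀ t, 0 < t → t < n → ∀ i, E.par^[i] w ≠ p t

theorem ReturnsTo.sameClass {E : EarSystem D L} {w u : V} (h : E.ReturnsTo k c w u) :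
    E.SameClass k c w u := by
  obtain ⟨n, p, i, hn, rfl, rfl, -, hp, -⟩ := h
  exact E.sameClass_of_forall_succ (fun i hi => (hp i hi).2.2) 0 n hn le_rfl

theorem ReturnsTo.time_lt {E : EarSystem D L} {w u : V} (h : E.ReturnsTo k c w u) :
    E.time u < E.time w := by
  obtain ⟨n, p, i, hn, rfl, rfl, -, hp, -⟩ := h
  exact gt_of_forall_gt_succ (g := fun i => E.time (p i)) (fun i hi => (hp i hi).2.1) 0 n hn le_rfl

/-- Two different such ancestors would be at distance at least `k` from `w` and from each other, by
the local colouring, and the two chains from `w` would contradict `false_of_two_paths_to_ancestors`.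
-/
theorem ReturnsTo.eq {E : EarSystem D L} (hk : 2 ≤ k) (hfree : ¬ D.ContainsBispindle k 1 k)
    (hc : E.IsLocalColoring k c) {w u₁ u₂ : V} (h₁ : E.ReturnsTo k c w u₁)
    (h₂ : E.ReturnsTo k c w u₂) : u₁ = u₂ := by
  have key : ∀ {u₁ u₂ : V} {i₁ i₂ : ℕ}, E.ReturnsTo k c w u₁ → E.ReturnsTo k c w u₂ →
      u₁ = E.par^[i₁] w → u₂ = E.par^[i₂] w → i₁ ≤ i₂ → u₁ = u₂ := by
    intro u₁ u₂ i₁ i₂ h₁ h₂ e₁ e₂ hle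
    by_contra hne
    have hs₁ := h₁.sameClass
    have hs₂ := h₂.sameClass
    have ht₁ := h₁.time_lt
    have hi₁ : k ≤ i₁ := hc.le_of_sameClass (e₁ ▸ hs₁.symm) (by
      rw [← e₁]; rintro rfl; exact ht₁.ne rfl)
    have e₂' : u₂ = E.par^[i₂ - i₁] u₁ := by
      rw [e₁, ← Function.iterate_add_apply, e₂]
      congr 1; omega
    have hi₂ : k ≤ i₂ - i₁ := hc.le_of_sameClass (e₂' ▸ hs₂.symm.trans hs₁)
      (by rw [← e₂']; exact fun h => hne h.symm)
    have hd : i₂ ≤ E.depth w := by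
      by_contra! h
      exact hs₂.2.1.1 (e₂.trans (E.par_iterate_eq_root_iff.2 h.le))
    obtain ⟨n, p, -, hn, hp0, hpn, -, hp, hpa⟩ := h₁
    obtain ⟨m, q, -, hm, hq0, hqm, -, hq, hqa⟩ := h₂
    refine E.false_of_two_paths_to_ancestors hk hfree hi₁ (by omega) hd hn hp0 hq0
      (hpn.trans e₁) (hqm.trans e₂) (fun i hi => (hp i hi).1) (fun i hi => (hq i hi).1) ?_ ?_ hpa hqa
    · exact fun i j hij hj he => absurd (congrArg E.time he)
        (gt_of_forall_gt_succ (g := fun i => E.time (p i)) (fun i hi => (hp i hi).2.1) i j hij hj).ne'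
    · exact fun i j hij hj he => absurd (congrArg E.time he)
        (gt_of_forall_gt_succ (g := fun i => E.time (q i)) (fun i hi => (hq i hi).2.1) i j hij hj).ne'
  obtain ⟨i₁, e₁⟩ : ∃ i, u₁ = E.par^[i] w := let ⟨_, _, i, _, _, _, h, _⟩ := h₁; ⟨i, h⟩
  obtain ⟨i₂, e₂⟩ : ∃ i, u₂ = E.par^[i] w := let ⟨_, _, i, _, _, _, h, _⟩ := h₂; ⟨i, h⟩
  rcases le_total i₁ i₂ with h | h
  · exact key h₁ h₂ e₁ e₂ h
  · exact (key h₂ h₁ e₂ e₁ h).symm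

/-- The components of the colour are the position, the local colour, the rank for arcs to later
ears, a bit that separates `w` from the ancestor it returns to, and the rank for the arcs to earlier
ears on which the bit is constant. -/
theorem exists_head_coloring [Finite V] (E : EarSystem D (2 * k)) (hk : 2 ≤ k)
    (hfree : ¬ D.ContainsBispindle k 1 k) :
    ∃ f : V → Fin k × Fin (k * k) × Fin k × Fin 2 × Fin k,
      ∀ u v, E.IsHead k u → E.IsHead k v → u ≠ v → D.Adj u v → f u ≠ f v := by
  classical
  obtain ⟨c, hc⟩ := E.exists_isLocalColoring k (by omega)
  obtain ⟨f, hf⟩ := exists_rank_coloring (E.Later k c) k (by omega) (no_later_chain hk hfree hc)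
  obtain ⟨b, hb⟩ : ∃ b : V → Fin 2, ∀ w u, E.ReturnsTo k c w u → b u ≠ b w := by
    have := Fintype.ofFinite V
    obtain ⟨b, hb⟩ := exists_greedy_coloring E.time
      (fun w => Finset.univ.filter fun u => E.ReturnsTo k c w u) 2 (fun w => by
        refine Nat.lt_succ_of_le (Finset.card_le_one.2 fun u₁ h₁ u₂ h₂ => ?_)
        exact ReturnsTo.eq hk hfree hc (Finset.mem_filter.1 h₁).2 (Finset.mem_filter.1 h₂).2)
    exact ⟨b, fun w u h => hb w u (by simpa using h) h.time_lt⟩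
  obtain ⟨g, hg⟩ := exists_rank_coloring (fun u v => E.Earlier k c u v ∧ b u = b v) k (by omega) (by
    intro v h
    -- The first vertex of the chain that lies above `v 0` is a return and has the other bit; if
    -- there is none, `no_earlier_chain` applies.
    by_cases hex : ∃ t, (1 ≤ t ∧ t ≤ k) ∧ ∃ i, E.par^[i] (v 0) = v t
    · obtain ⟨⟨ht1, htk⟩, i, hi⟩ := Nat.find_spec hex
      have hmin : ∀ t', t' < Nat.find hex → ¬ ((1 ≤ t' ∧ t' ≤ k) ∧ ∃ i, E.par^[i] (v 0) = v t') :=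
        fun t' ht' => Nat.find_min hex ht'
      generalize Nat.find hex = t at ht1 htk hi hmin
      refine hb (v 0) (v t) ⟨t, v, i, ht1, rfl, rfl, hi.symm, fun i hi => (h i (by omega)).1, ?_⟩ ?_
      · intro t' h1 h2 i hi
        exact hmin t' h2 ⟨⟨h1, by omega⟩, i, hi⟩
      · exact forall_eq_of_forall_eq_succ (g := fun i => b (v i)) (n := k)
          (fun i hi => (h i hi).2) t htk
    · push Not at hex
      exact no_earlier_chain hk hfree v (fun i t h1 h2 => hex t ⟨h1, h2⟩ i) fun i hi => (h i hi).1)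
  -- The remainder only serves to give a value in `Fin k` everywhere; at the vertices to be coloured
  -- it is the position itself.
  refine ⟨fun v => (⟨E.pos v % k, Nat.mod_lt _ (by omega)⟩, c v, f v, b v, g v), ?_⟩
  intro u v hu hv hne hadj h
  simp only [Prod.mk.injEq, Fin.mk.injEq] at h
  obtain ⟨h1, h2, h3, h4, h5⟩ := h
  rw [Nat.mod_eq_of_lt hu.2, Nat.mod_eq_of_lt hv.2] at h1
  have hs : E.SameClass k c u v := ⟨hu, hv, h1, h2⟩
  rcases Nat.lt_trichotomy (E.time u) (E.time v) with ht | ht | ht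
  · exact hf u v ⟨hadj, ht, hs⟩ h3
  · exact hne (E.pos_inj _ _ ht h1)
  · exact hg u v ⟨⟨hadj, ht, hs⟩, h4⟩ h5

/-! ### Colouring a digraph with an ear system -/

/-- Disjoint palettes serve the root, the starts of the ears, their ends (the starts in the reversed
system) and the remaining vertices. Among the latter, arcs stay on one ear and join positions less
than `k` apart, so positions modulo `k` suffice. -/
theorem colorable [Finite V] (E : EarSystem D (2 * k)) (hk : 2 ≤ k)
    (hfree : ¬ D.ContainsBispindle k 1 k) :
    D.toSimpleGraphInclusive.Colorable (earSystemBound k) := by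
  classical
  obtain ⟨f, hf⟩ := E.exists_head_coloring hk hfree
  have hfree' : ¬ D.rev.ContainsBispindle k 1 k := fun h => hfree h.of_rev
  obtain ⟨g, hg⟩ := E.reverse.exists_head_coloring hk hfree'
  let β := Fin k × Fin (k * k) × Fin k × Fin 2 × Fin k
  let col : V → (Unit ⊕ Fin k) ⊕ (β ⊕ β) := fun v =>
    if v = E.root then Sum.inl (Sum.inl ())
    else if E.pos v < k then Sum.inr (Sum.inl (f v))
    else if E.copos v < k then Sum.inr (Sum.inr (g v))
    else Sum.inl (Sum.inr ⟨E.pos v % k, Nat.mod_lt _ (by omega)⟩)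
  have hcol : ∀ u v, u ≠ v → D.Adj u v → col u ≠ col v := by
    intro u v hne hadj h
    simp only [col] at h
    split_ifs at h with h1 h2 h3 h4 h5 h6 h7 h8 h9
    all_goals first | (simp at h; done) | skip
    · exact hne (h1.trans h2.symm)
    · simp only [Sum.inr.injEq, Sum.inl.injEq] at h
      exact hf u v ⟨h1, h5⟩ ⟨‹_›, ‹_›⟩ hne hadj h
    · simp only [Sum.inr.injEq] at h
      exact hg v u ⟨‹_›, ‹_›⟩ ⟨h1, ‹_›⟩ hne.symm hadj h.symm
    · simp only [Sum.inr.injEq, Sum.inl.injEq, Fin.mk.injEq] at h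
      have hu : u ≠ E.root := h1
      have hv : v ≠ E.root := ‹_›
      rcases Nat.lt_trichotomy (E.time u) (E.time v) with ht | ht | ht
      · exact E.not_adj_of_time_lt hk hfree ht (by omega) (by omega) hadj
      · rcases Nat.lt_trichotomy (E.pos u) (E.pos v) with hp | hp | hp
        · have := E.forward_chord_lt hk hfree hv ht hp (by omega) (by omega) hadj
          have h' := (Nat.modEq_iff_dvd' hp.le).1 h
          have := Nat.le_of_dvd (by omega) h'
          omega
        · exact hne (E.pos_inj _ _ ht hp)
        · have := E.backward_chord_lt hk hfree hv ht hp (by omega) hadj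
          have h' := (Nat.modEq_iff_dvd' hp.le).1 h.symm
          have := Nat.le_of_dvd (by omega) h'
          omega
      · exact E.reverse.not_adj_of_time_lt hk hfree' (u := u) (v := v) ht
          (show k ≤ E.copos u by omega) (show k ≤ E.pos u by omega) hadj
  have hC : D.toSimpleGraphInclusive.Coloring ((Unit ⊕ Fin k) ⊕ (β ⊕ β)) :=
    SimpleGraph.Coloring.mk col (by
      intro u v huv
      rcases huv with ⟨hne, h | h⟩
      · exact hcol u v hne h
      · exact (hcol v u hne.symm h).symm)
  have hcard : Fintype.card ((Unit ⊕ Fin k) ⊕ (β ⊕ β)) = earSystemBound k := by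
    simp only [β, Fintype.card_sum, Fintype.card_prod, Fintype.card_fin, Fintype.card_unit,
      earSystemBound]
    ring
  rw [← hcard]
  exact hC.colorable

end EarSystem

/-! ### Reachability and strong connectivity -/

theorem IsDipath.exists_of_reflTransGen {D : Digraph V} {x y : V}
    (h : Relation.ReflTransGen D.Adj x y) : ∃ P : List V, D.IsDipath x y P := by
  induction h using Relation.ReflTransGen.head_induction_on with
  | refl => exact ⟨[y], ⟨rfl, rfl, by simp, by simp⟩⟩
  | @head a b hab _ ih =>
    obtain ⟨P, hP⟩ := ih
    by_cases ha : a ∈ P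
    · obtain ⟨P₁, P₂, rfl⟩ := List.append_of_mem ha
      refine ⟨a :: P₂, rfl, ?_, (List.nodup_append'.1 hP.nodup).2.1,
        (List.isChain_append.1 hP.chain).2.1⟩
      rw [← hP.last, List.getLast?_append_of_ne_nil _ (by simp)]
    · refine ⟨a :: P, rfl, ?_, List.nodup_cons.2 ⟨ha, hP.nodup⟩, ?_⟩
      · rw [List.getLast?_cons, hP.last]
        rfl
      · refine List.isChain_cons.2 ⟨?_, hP.chain⟩
        intro c hc
        rw [hP.head] at hc
        cases hc
        exact hab

theorem IsDipath.reflTransGen {D : Digraph V} {x y : V} {P : List V} (h : D.IsDipath x y P) :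
    Relation.ReflTransGen D.Adj x y := by
  induction P generalizing x with
  | nil => simpa using h.head
  | cons a P ih =>
    obtain rfl : a = x := by simpa using h.head
    cases P with
    | nil =>
      obtain rfl : a = y := by simpa using h.last
      exact .refl
    | cons b P =>
      have hc := List.isChain_cons_cons.1 h.chain
      exact .head hc.1 (ih ⟨rfl, by simpa [List.getLast?_cons_cons] using h.last,
        (List.nodup_cons.1 h.nodup).2, hc.2⟩)

theorem IsStrong.of_reflTransGen {D : Digraph V}
    (h : ∀ x y, Relation.ReflTransGen D.Adj x y) : D.IsStrong :=
  fun x y => IsDipath.exists_of_reflTransGen (h x y)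

theorem EarSystem.isStrong {D : Digraph V} {L : ℕ} (E : EarSystem D L) : D.IsStrong := by
  have h₁ : ∀ n v, E.depth v = n → Relation.ReflTransGen D.Adj E.root v := by
    intro n
    induction n with
    | zero => intro v hv; rw [E.depth_eq_zero hv]
    | succ n ih =>
      intro v hv
      have hr : v ≠ E.root := by rintro rfl; simp [E.depth_root] at hv
      exact .tail (ih _ (by have := E.depth_par v hr; omega)) (E.adj_par v hr)
  have h₂ : ∀ n v, E.height v = n → Relation.ReflTransGen D.Adj v E.root := by
    intro n
    induction n with
    | zero => intro v hv; rw [E.reverse.depth_eq_zero (v := v) hv]; exact .refl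
    | succ n ih =>
      intro v hv
      have hr : v ≠ E.root := by rintro rfl; simp [E.height_root] at hv
      exact .head (E.adj_nxt v hr) (ih _ (by have := E.height_nxt v hr; omega))
  exact .of_reflTransGen fun x y => (h₂ _ x rfl).trans (h₁ _ y rfl)

/-! ### Attaching ears, and the partition into maximal parts -/

/-- An ear decomposition of the subdigraph induced by a set `S` of vertices, with data defined on
all vertices. -/
structure EarSystemOn (D : Digraph V) (L : ℕ) (root : V) (S : Set V) where
  time : V → ℕ
  pos : V → ℕ
  copos : V → ℕ
  depth : V → ℕ
  height : V → ℕ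
  par : V → V
  nxt : V → V
  root_mem : root ∈ S
  par_mem : ∀ v ∈ S, par v ∈ S
  nxt_mem : ∀ v ∈ S, nxt v ∈ S
  par_root : par root = root
  nxt_root : nxt root = root
  depth_root : depth root = 0
  height_root : height root = 0
  time_root : time root = 0
  time_pos : ∀ v ∈ S, v ≠ root → 0 < time v
  adj_par : ∀ v ∈ S, v ≠ root → D.Adj (par v) v
  adj_nxt : ∀ v ∈ S, v ≠ root → D.Adj v (nxt v)
  depth_par : ∀ v ∈ S, v ≠ root → depth v = depth (par v) + 1
  height_nxt : ∀ v ∈ S, v ≠ root → height v = height (nxt v) + 1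
  par_cases : ∀ v ∈ S, v ≠ root → (time (par v) < time v ∧ pos v = 1) ∨
    (time (par v) = time v ∧ pos v = pos (par v) + 1 ∧ copos (par v) = copos v + 1 ∧
      nxt (par v) = v)
  nxt_cases : ∀ v ∈ S, v ≠ root → (time (nxt v) < time v ∧ copos v = 1) ∨
    (time (nxt v) = time v ∧ copos v = copos (nxt v) + 1 ∧ pos (nxt v) = pos v + 1 ∧
      par (nxt v) = v)
  pos_inj : ∀ u ∈ S, ∀ v ∈ S, time u = time v → pos u = pos v → u = v
  copos_inj : ∀ u ∈ S, ∀ v ∈ S, time u = time v → copos u = copos v → u = v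
  length_le : ∀ v ∈ S, v ≠ root → L ≤ pos v + copos v

namespace EarSystemOn

variable {D : Digraph V} {L : ℕ} {r : V} {S : Set V}

/-- The ear decomposition of the induced subdigraph. -/
def toEarSystem (E : EarSystemOn D L r S) : EarSystem (D.induce S) L where
  root := ⟨r, E.root_mem⟩
  time v := E.time v
  pos v := E.pos v
  copos v := E.copos v
  depth v := E.depth v
  height v := E.height v
  par v := ⟨E.par v, E.par_mem v v.2⟩
  nxt v := ⟨E.nxt v, E.nxt_mem v v.2⟩
  par_root := Subtype.ext E.par_root
  nxt_root := Subtype.ext E.nxt_root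
  depth_root := E.depth_root
  height_root := E.height_root
  time_root := E.time_root
  time_pos v hv := E.time_pos v v.2 fun h => hv (Subtype.ext h)
  adj_par v hv := E.adj_par v v.2 fun h => hv (Subtype.ext h)
  adj_nxt v hv := E.adj_nxt v v.2 fun h => hv (Subtype.ext h)
  depth_par v hv := E.depth_par v v.2 fun h => hv (Subtype.ext h)
  height_nxt v hv := E.height_nxt v v.2 fun h => hv (Subtype.ext h)
  par_cases v hv := (E.par_cases v v.2 fun h => hv (Subtype.ext h)).imp_right
    fun ⟨h₁, h₂, h₃, h₄⟩ => ⟨h₁, h₂, h₃, Subtype.ext h₄⟩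
  nxt_cases v hv := (E.nxt_cases v v.2 fun h => hv (Subtype.ext h)).imp_right
    fun ⟨h₁, h₂, h₃, h₄⟩ => ⟨h₁, h₂, h₃, Subtype.ext h₄⟩
  pos_inj u v h₁ h₂ := Subtype.ext (E.pos_inj u u.2 v v.2 h₁ h₂)
  copos_inj u v h₁ h₂ := Subtype.ext (E.copos_inj u u.2 v v.2 h₁ h₂)
  length_le v hv := E.length_le v v.2 fun h => hv (Subtype.ext h)

/-- The ear decomposition of a single vertex. -/
def single (D : Digraph V) (L : ℕ) (r : V) : EarSystemOn D L r {r} where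
  time _ := 0
  pos _ := 0
  copos _ := 0
  depth _ := 0
  height _ := 0
  par v := v
  nxt v := v
  root_mem := rfl
  par_mem _ h := h
  nxt_mem _ h := h
  par_root := rfl
  nxt_root := rfl
  depth_root := rfl
  height_root := rfl
  time_root := rfl
  time_pos _ hv hr := absurd hv hr
  adj_par _ hv hr := absurd hv hr
  adj_nxt _ hv hr := absurd hv hr
  depth_par _ hv hr := absurd hv hr
  height_nxt _ hv hr := absurd hv hr
  par_cases _ hv hr := absurd hv hr
  nxt_cases _ hv hr := absurd hv hr
  pos_inj _ hu _ hv _ _ := hu.trans hv.symm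
  copos_inj _ hu _ hv _ _ := hu.trans hv.symm
  length_le _ hv hr := absurd hv hr

end EarSystemOn

/-- The sequence `f 0, …, f (m + 1)` is an ear of length at least `L` attached to `S`. -/
structure IsEar (D : Digraph V) (L : ℕ) (S : Set V) (f : ℕ → V) (m : ℕ) : Prop where
  one_le : 1 ≤ m
  length_le : L ≤ m + 1
  adj : ∀ i ≤ m, D.Adj (f i) (f (i + 1))
  start_mem : f 0 ∈ S
  end_mem : f (m + 1) ∈ S
  notMem : ∀ i, 1 ≤ i → i ≤ m → f i ∉ S
  inj : ∀ i j, 1 ≤ i → i ≤ m → 1 ≤ j → j ≤ m → f i = f j → i = j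

theorem EarSystemOn.extend [Finite V] {D : Digraph V} {L : ℕ} {r : V} {S : Set V}
    (E : EarSystemOn D L r S) {f : ℕ → V} {m : ℕ} (hf : D.IsEar L S f m) :
    Nonempty (EarSystemOn D L r (S ∪ {v | ∃ i, 1 ≤ i ∧ i ≤ m ∧ f i = v})) := by
  classical
  -- `p v` is the index of `v` on the new ear, and `0` for all other vertices, including the two old
  -- ends of the ear.
  obtain ⟨p, hp0, hpf, hpS⟩ : ∃ p : V → ℕ, (∀ v, p v ≠ 0 → p v ≤ m ∧ f (p v) = v) ∧
      (∀ i, 1 ≤ i → i ≤ m → p (f i) = i) ∧ ∀ v ∈ S, p v = 0 := by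
    refine ⟨fun v => if h : ∃ i, 1 ≤ i ∧ i ≤ m ∧ f i = v then h.choose else 0, ?_, ?_, ?_⟩
    · intro v hv
      by_cases h : ∃ i, 1 ≤ i ∧ i ≤ m ∧ f i = v
      · simp only [dif_pos h]
        exact h.choose_spec.2
      · simp [dif_neg h] at hv
    · intro i h₁ h₂
      have h : ∃ j, 1 ≤ j ∧ j ≤ m ∧ f j = f i := ⟨i, h₁, h₂, rfl⟩
      simp only [dif_pos h]
      have hs := h.choose_spec
      exact hf.inj _ _ hs.1 hs.2.1 h₁ h₂ hs.2.2
    · intro v hv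
      have h : ¬ ∃ i, 1 ≤ i ∧ i ≤ m ∧ f i = v := by
        rintro ⟨i, h₁, h₂, rfl⟩
        exact hf.notMem i h₁ h₂ hv
      simp [dif_neg h]
  have hset : S ∪ {v | ∃ i, 1 ≤ i ∧ i ≤ m ∧ f i = v} = S ∪ {v | p v ≠ 0} := by
    ext v
    simp only [Set.mem_union, Set.mem_ofPred_eq]
    refine or_congr_right ⟨?_, fun h => ⟨p v, Nat.pos_of_ne_zero h, hp0 v h⟩⟩
    rintro ⟨i, h₁, h₂, rfl⟩
    rw [hpf i h₁ h₂]
    omega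
  rw [hset]
  -- The new ear receives the number `T + 1`, later than all values of `E.time`, those outside `S`
  -- included.
  obtain ⟨T, hT⟩ : ∃ T, ∀ v, E.time v ≤ T := by
    obtain ⟨T, hT⟩ := (Set.finite_range E.time).bddAbove
    exact ⟨T, fun v => hT ⟨v, rfl⟩⟩
  have hm := hf.one_le
  have hpr : p r = 0 := hpS r E.root_mem
  have hpstart := hpS _ hf.start_mem
  have hpend := hpS _ hf.end_mem
  have hold : ∀ v ∈ S ∪ {v | p v ≠ 0}, p v = 0 → v ∈ S := by
    rintro v (hv | hv) h
    · exact hv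
    · exact absurd h hv
  have hprev : ∀ v, p v ≠ 0 → p (f (p v - 1)) = p v - 1 := by
    intro v hv
    rcases Nat.eq_or_lt_of_le (Nat.one_le_iff_ne_zero.2 hv) with h | h
    · rw [← h]; exact hpstart
    · exact hpf _ (by omega) (by have := (hp0 v hv).1; omega)
  have hnext : ∀ v, p v ≠ 0 → (p v = m ∧ p (f (p v + 1)) = 0) ∨
      (p v < m ∧ p (f (p v + 1)) = p v + 1) := by
    intro v hv
    rcases Nat.eq_or_lt_of_le (hp0 v hv).1 with h | h
    · left; refine ⟨h, ?_⟩; rw [h]; exact hpend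
    · right; exact ⟨h, hpf _ (by omega) (by omega)⟩
  have hadj_prev : ∀ v, p v ≠ 0 → D.Adj (f (p v - 1)) v := by
    intro v hv
    have := hf.adj (p v - 1) (by have := (hp0 v hv).1; omega)
    rwa [Nat.sub_add_cancel (Nat.one_le_iff_ne_zero.2 hv), (hp0 v hv).2] at this
  have hadj_next : ∀ v, p v ≠ 0 → D.Adj v (f (p v + 1)) := by
    intro v hv
    have := hf.adj (p v) (hp0 v hv).1
    rwa [(hp0 v hv).2] at this
  have hmem : ∀ i ≤ m + 1, f i ∈ S ∪ {v | p v ≠ 0} := by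
    intro i hi
    rcases Nat.eq_zero_or_pos i with rfl | h0
    · exact Or.inl hf.start_mem
    · rcases Nat.eq_or_lt_of_le hi with rfl | h
      · exact Or.inl hf.end_mem
      · right
        change p (f i) ≠ 0
        rw [hpf i h0 (by omega)]
        omega
  have hparS : ∀ v ∈ S, p (E.par v) = 0 := fun v hv => hpS _ (E.par_mem v hv)
  have hnxtS : ∀ v ∈ S, p (E.nxt v) = 0 := fun v hv => hpS _ (E.nxt_mem v hv)
  have hr0 : ∀ v, p v ≠ 0 → v ≠ r := fun v hv h => hv (h ▸ hpr)
  refine ⟨{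
    time := fun v => if p v = 0 then E.time v else T + 1
    pos := fun v => if p v = 0 then E.pos v else p v
    copos := fun v => if p v = 0 then E.copos v else m + 1 - p v
    depth := fun v => if p v = 0 then E.depth v else E.depth (f 0) + p v
    height := fun v => if p v = 0 then E.height v else E.height (f (m + 1)) + (m + 1 - p v)
    par := fun v => if p v = 0 then E.par v else f (p v - 1)
    nxt := fun v => if p v = 0 then E.nxt v else f (p v + 1)
    root_mem := Or.inl E.root_mem
    par_mem := ?_
    nxt_mem := ?_
    par_root := by simp [hpr, E.par_root]
    nxt_root := by simp [hpr, E.nxt_root]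
    depth_root := by simp [hpr, E.depth_root]
    height_root := by simp [hpr, E.height_root]
    time_root := by simp [hpr, E.time_root]
    time_pos := ?_
    adj_par := ?_
    adj_nxt := ?_
    depth_par := ?_
    height_nxt := ?_
    par_cases := ?_
    nxt_cases := ?_
    pos_inj := ?_
    copos_inj := ?_
    length_le := ?_ }⟩
  · intro v hv
    by_cases h : p v = 0
    · simp only [if_pos h]
      exact Or.inl (E.par_mem v (hold v hv h))
    · simp only [if_neg h]
      exact hmem _ (by have := (hp0 v h).1; omega)
  · intro v hv
    by_cases h : p v = 0
    · simp only [if_pos h]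
      exact Or.inl (E.nxt_mem v (hold v hv h))
    · simp only [if_neg h]
      exact hmem _ (by have := (hp0 v h).1; omega)
  · intro v hv hr
    by_cases h : p v = 0
    · simp only [if_pos h]
      exact E.time_pos v (hold v hv h) hr
    · simp only [if_neg h]
      omega
  · intro v hv hr
    by_cases h : p v = 0
    · simp only [if_pos h]
      exact E.adj_par v (hold v hv h) hr
    · simp only [if_neg h]
      exact hadj_prev v h
  · intro v hv hr
    by_cases h : p v = 0
    · simp only [if_pos h]
      exact E.adj_nxt v (hold v hv h) hr
    · simp only [if_neg h]
      exact hadj_next v h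
  · intro v hv hr
    by_cases h : p v = 0
    · have hS := hold v hv h
      simp only [if_pos h, if_pos (hparS v hS)]
      exact E.depth_par v hS hr
    · simp only [if_neg h, hprev v h]
      split_ifs with h1
      · rw [h1]; omega
      · omega
  · intro v hv hr
    by_cases h : p v = 0
    · have hS := hold v hv h
      simp only [if_pos h, if_pos (hnxtS v hS)]
      exact E.height_nxt v hS hr
    · simp only [if_neg h]
      rcases hnext v h with ⟨h1, h2⟩ | ⟨h1, h2⟩
      · rw [if_pos h2, h1]; omega
      · rw [h2, if_neg (by omega)]; omega
  · intro v hv hr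
    by_cases h : p v = 0
    · have hS := hold v hv h
      have hp := hparS v hS
      simp only [if_pos h, if_pos hp]
      exact E.par_cases v hS hr
    · simp only [if_neg h, hprev v h]
      by_cases h1 : p v - 1 = 0
      · left
        simp only [if_pos h1]
        exact ⟨Nat.lt_succ_of_le (hT _), by omega⟩
      · right
        simp only [if_neg h1]
        refine ⟨trivial, by omega, by have := (hp0 v h).1; omega, ?_⟩
        rw [show p v - 1 + 1 = p v by omega]
        exact (hp0 v h).2
  · intro v hv hr
    by_cases h : p v = 0
    · have hS := hold v hv h
      have hp := hnxtS v hS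
      simp only [if_pos h, if_pos hp]
      exact E.nxt_cases v hS hr
    · simp only [if_neg h]
      rcases hnext v h with ⟨h1, h2⟩ | ⟨h1, h2⟩
      · left
        simp only [if_pos h2]
        exact ⟨Nat.lt_succ_of_le (hT _), by omega⟩
      · right
        simp only [h2, if_neg (Nat.succ_ne_zero (p v))]
        refine ⟨trivial, by omega, trivial, ?_⟩
        rw [show p v + 1 - 1 = p v by omega]
        exact (hp0 v h).2
  · intro u hu v hv ht hpos
    by_cases h : p u = 0 <;> by_cases h' : p v = 0
    · simp only [if_pos h, if_pos h'] at ht hpos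
      exact E.pos_inj u (hold u hu h) v (hold v hv h') ht hpos
    · simp only [if_pos h, if_neg h'] at ht
      have := hT u; omega
    · simp only [if_neg h, if_pos h'] at ht
      have := hT v; omega
    · simp only [if_neg h, if_neg h'] at hpos
      rw [← (hp0 u h).2, ← (hp0 v h').2, hpos]
  · intro u hu v hv ht hpos
    by_cases h : p u = 0 <;> by_cases h' : p v = 0
    · simp only [if_pos h, if_pos h'] at ht hpos
      exact E.copos_inj u (hold u hu h) v (hold v hv h') ht hpos
    · simp only [if_pos h, if_neg h'] at ht
      have := hT u; omega
    · simp only [if_neg h, if_pos h'] at ht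
      have := hT v; omega
    · simp only [if_neg h, if_neg h'] at hpos
      have h1 := (hp0 u h).1
      have h2 := (hp0 v h').1
      rw [← (hp0 u h).2, ← (hp0 v h').2, show p u = p v by omega]
  · intro v hv hr
    by_cases h : p v = 0
    · simp only [if_pos h]
      exact E.length_le v (hold v hv h) hr
    · simp only [if_neg h]
      have := hf.length_le
      have := (hp0 v h).1
      omega

/-- Every finite digraph can be partitioned into parts with an ear decomposition, ordered in such
a way that no ear can be attached to a part using later parts only. -/
theorem exists_ear_partition [Finite V] (D : Digraph V) (L : ℕ) (W : Set V) : ∃ π : V → ℕ,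
    (∀ v ∈ W, ∃ r, Nonempty (EarSystemOn D L r {u | u ∈ W ∧ π u = π v})) ∧
    ∀ (i m : ℕ) (f : ℕ → V), D.IsEar L {u | u ∈ W ∧ π u = i} f m →
      ¬ ∀ j, 1 ≤ j → j ≤ m → f j ∈ W ∧ i < π (f j) := by
  classical
  induction hn : W.ncard using Nat.strong_induction_on generalizing W with
  | _ n ih =>
  rcases W.eq_empty_or_nonempty with rfl | ⟨r, hr⟩
  · exact ⟨fun _ => 0, by simp, fun i m f hf => absurd hf.start_mem (by simp)⟩
  obtain ⟨S, hrS, hS⟩ := (Set.toFinite {S : Set V | S ⊆ W ∧ Nonempty (EarSystemOn D L r S)}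
    ).exists_le_maximal (a := {r}) ⟨by simpa using hr, ⟨.single D L r⟩⟩
  obtain ⟨hSW, ⟨E⟩⟩ := hS.prop
  have hlt : (W \ S).ncard < n := by
    rw [← hn]
    refine Set.ncard_lt_ncard ⟨Set.sdiff_subset, fun h => (h hr).2 (hrS rfl)⟩ (Set.toFinite W)
  obtain ⟨π, hπ, hear⟩ := ih _ hlt (W \ S) rfl
  refine ⟨fun v => if v ∈ S then 0 else π v + 1, ?_, ?_⟩
  · intro v hv
    by_cases hvS : v ∈ S
    · refine ⟨r, ?_⟩
      have : {u | u ∈ W ∧ (if u ∈ S then 0 else π u + 1) = if v ∈ S then 0 else π v + 1} = S := by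
        ext u
        simp only [if_pos hvS, Set.mem_ofPred_eq]
        by_cases hu : u ∈ S
        · simp [hu, hSW hu]
        · simp [hu]
      rw [this]
      exact ⟨E⟩
    · obtain ⟨r', hr'⟩ := hπ v ⟨hv, hvS⟩
      refine ⟨r', ?_⟩
      have : {u | u ∈ W ∧ (if u ∈ S then 0 else π u + 1) = if v ∈ S then 0 else π v + 1} =
          {u | u ∈ W \ S ∧ π u = π v} := by
        ext u
        simp only [if_neg hvS, Set.mem_ofPred_eq, Set.mem_sdiff]
        by_cases hu : u ∈ S <;> simp [hu]
      rw [this]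
      exact hr'
  · intro i m f hf hj
    cases i with
    | zero =>
      have hpart : {u | u ∈ W ∧ (if u ∈ S then 0 else π u + 1) = 0} = S := by
        ext u
        simp only [Set.mem_ofPred_eq]
        by_cases hu : u ∈ S
        · simp [hu, hSW hu]
        · simp [hu]
      rw [hpart] at hf
      have hle := hS.le_of_ge (y := S ∪ {v | ∃ i, 1 ≤ i ∧ i ≤ m ∧ f i = v}) ⟨?_, E.extend hf⟩
        Set.subset_union_left
      · exact hf.notMem 1 le_rfl hf.one_le (hle (Or.inr ⟨1, le_rfl, hf.one_le, rfl⟩))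
      · rintro v (hv | ⟨i, h1, h2, rfl⟩)
        · exact hSW hv
        · exact (hj i h1 h2).1
    | succ i =>
      have hpart : {u | u ∈ W ∧ (if u ∈ S then 0 else π u + 1) = i + 1} =
          {u | u ∈ W \ S ∧ π u = i} := by
        ext u
        simp only [Set.mem_ofPred_eq, Set.mem_sdiff]
        by_cases hu : u ∈ S <;> simp [hu]
      rw [hpart] at hf
      refine hear i m f hf fun j h1 h2 => ?_
      obtain ⟨h3, h4⟩ := hj j h1 h2
      by_cases hu : f j ∈ S
      · simp [hu] at h4
      · simp only [if_neg hu] at h4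
        exact ⟨⟨h3, hu⟩, by omega⟩

/-- The total weight of the consecutive pairs of a list. -/
def walkWeight (w : V → V → ℤ) : List V → ℤ
  | a :: b :: l => w a b + walkWeight w (b :: l)
  | _ => 0

theorem walkWeight_append (w : V → V → ℤ) (l : List V) (a : V) (l' : List V) :
    walkWeight w (l ++ a :: l') = walkWeight w (l ++ [a]) + walkWeight w (a :: l') := by
  induction l with
  | nil => simp [walkWeight]
  | cons b l ih =>
    cases l with
    | nil => simp [walkWeight]
    | cons c l =>
      simp only [List.cons_append, walkWeight] at ih ⊢
      rw [ih]
      ring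

/-- If there is no closed walk of positive weight through distinct vertices, there is a potential
that drops along every arc by at least its weight. -/
theorem exists_potential [Finite V] {D : Digraph V} (hD : D.IsStrong) (w : V → V → ℤ)
    (hw : ∀ (a : V) (l : List V), (a :: l).Nodup → (a :: (l ++ [a])).IsChain D.Adj →
      walkWeight w (a :: (l ++ [a])) ≤ 0) :
    ∃ f : V → ℤ, ∀ u v, D.Adj u v → f v + w u v ≤ f u := by
  rcases isEmpty_or_nonempty V with hV | ⟨⟨r⟩⟩
  · exact ⟨fun _ => 0, fun u => (IsEmpty.false u).elim⟩
  have hfin : {P : List V | P.Nodup}.Finite := by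
    have := Fintype.ofFinite V
    classical
    exact (List.finite_length_le V (Fintype.card V)).subset fun P hP => List.Nodup.length_le_card hP
  have hbest : ∀ v, ∃ P, D.IsDipath v r P ∧ ∀ Q, D.IsDipath v r Q →
      walkWeight w Q ≤ walkWeight w P := fun v =>
    Set.exists_max_image {P | D.IsDipath v r P} (walkWeight w)
      (hfin.subset fun P hP => hP.nodup) (hD v r)
  choose P hP hmax using hbest
  refine ⟨fun v => walkWeight w (P v), fun u v huv => ?_⟩
  change walkWeight w (P v) + w u v ≤ walkWeight w (P u)
  obtain ⟨R, hR⟩ : ∃ R, P v = v :: R := by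
    have := (hP v).head
    cases h : P v with
    | nil => simp [h] at this
    | cons a R => rw [h] at this; exact ⟨R, by simpa using this⟩
  have hPv := hP v
  by_cases hu : u ∈ P v
  · obtain ⟨P₁, P₂, h⟩ := List.append_of_mem hu
    rw [h] at hPv
    have hnd := List.nodup_append'.1 hPv.nodup
    have hch := List.isChain_append.1 hPv.chain
    have h₂ : D.IsDipath u r (u :: P₂) := by
      refine ⟨rfl, ?_, hnd.2.1, hch.2.1⟩
      rw [← hPv.last, List.getLast?_append_of_ne_nil _ (by simp)]
    have h₁ : w u v + walkWeight w (P₁ ++ [u]) = walkWeight w (u :: (P₁ ++ [u])) := by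
      cases P₁ with
      | nil =>
        obtain rfl : u = v := by
          rw [hR] at h
          simp only [List.nil_append, List.cons.injEq] at h
          exact h.1.symm
        simp [walkWeight]
      | cons a P₁ =>
        obtain rfl : a = v := by
          rw [hR] at h
          simp only [List.cons_append, List.cons.injEq] at h
          exact h.1.symm
        simp [walkWeight]
    have hc : walkWeight w (u :: (P₁ ++ [u])) ≤ 0 := by
      refine hw u P₁ (List.nodup_cons.2 ⟨fun hm => hnd.2.2 hm (by simp), hnd.1⟩) ?_
      refine List.isChain_cons.2 ⟨?_, ?_⟩
      · intro c hc
        have : (P v).head? = (P₁ ++ [u]).head? := by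
          rw [h]
          cases P₁ <;> simp
        rw [← this, hR] at hc
        obtain rfl : v = c := by simpa using hc
        exact huv
      · refine List.isChain_append.2 ⟨hch.1, by simp, ?_⟩
        intro a ha b hb
        exact hch.2.2 a ha b (by simpa using hb)
    have hm := hmax u _ h₂
    have hsplit := walkWeight_append w P₁ u P₂
    rw [← h] at hsplit
    omega
  · have hd : D.IsDipath u r (u :: P v) := by
      refine ⟨rfl, ?_, List.nodup_cons.2 ⟨hu, hPv.nodup⟩, List.isChain_cons.2 ⟨?_, hPv.chain⟩⟩
      · rw [List.getLast?_cons, hPv.last]; rfl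
      · intro c hc
        rw [hPv.head] at hc
        cases hc
        exact huv
    have hm := hmax u _ hd
    rw [hR] at hm ⊢
    simp only [walkWeight] at hm
    omega

/-- A maximal acyclic set of arcs: every other arc is antiparallel to a path in it. -/
theorem exists_maximal_acyclic [Finite V] (D : Digraph V) (hirr : ∀ v, ¬ D.Adj v v) :
    ∃ A : V → V → Prop, (∀ u v, A u v → D.Adj u v) ∧ (∀ v, ¬ Relation.TransGen A v v) ∧
      ∀ u v, D.Adj u v → ¬ A u v → Relation.TransGen A v u := by
  obtain ⟨A, -, hA⟩ := (Set.toFinite {A : V → V → Prop | (∀ u v, A u v → D.Adj u v) ∧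
      ∀ v, ¬ Relation.TransGen A v v}).exists_le_maximal (a := fun _ _ => False) ⟨fun _ _ h => h.elim, fun v h => by
      cases h with
      | single h => exact h
      | tail _ h => exact h⟩
  refine ⟨A, hA.prop.1, hA.prop.2, fun u v huv hnA => ?_⟩
  by_contra hno
  have hne : u ≠ v := by rintro rfl; exact hirr u huv
  have hno' : ¬ Relation.ReflTransGen A v u := by
    intro h
    rcases Relation.reflTransGen_iff_eq_or_transGen.1 h with h | h
    · exact hne h
    · exact hno h
  have key : ∀ x y, Relation.TransGen (fun a b => A a b ∨ (a = u ∧ b = v)) x y →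
      Relation.TransGen A x y ∨ (Relation.ReflTransGen A x u ∧ Relation.ReflTransGen A v y) := by
    intro x y h
    induction h with
    | single h =>
      rcases h with h | ⟨rfl, rfl⟩
      · exact Or.inl (.single h)
      · exact Or.inr ⟨.refl, .refl⟩
    | tail _ h ih =>
      rcases h with h | ⟨rfl, rfl⟩
      · exact ih.imp (fun h' => h'.tail h) fun h' => ⟨h'.1, h'.2.tail h⟩
      · rcases ih with ih | ih
        · exact Or.inr ⟨ih.to_reflTransGen, .refl⟩
        · exact absurd ih.2 hno'
  refine hnA (hA.le_of_ge (y := fun a b => A a b ∨ (a = u ∧ b = v)) ?_ (fun a b h => Or.inl h)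
    u v (Or.inr ⟨rfl, rfl⟩))
  refine ⟨?_, fun z hz => ?_⟩
  · rintro a b (h | ⟨rfl, rfl⟩)
    · exact hA.prop.1 a b h
    · exact huv
  rcases key z z hz with h | h
  · exact hA.prop.2 z h
  · exact hno' (h.2.trans h.1)

theorem transGen_of_isChain {R : V → V → Prop} {a b : V} {l : List V}
    (h : (a :: (l ++ [b])).IsChain R) : Relation.TransGen R a b := by
  induction l generalizing a with
  | nil => exact .single (by simpa using h)
  | cons c l ih =>
    have h' := List.isChain_cons_cons.1 h
    exact .head h'.1 (ih h'.2)

/-- A strong digraph without loops whose cycles have at most `c` vertices has chromatic number at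
most `(c - 1) ^ 2 + 1`. -/
theorem colorable_of_cycle_length_le [Finite V] {D : Digraph V} (hD : D.IsStrong)
    (hirr : ∀ v, ¬ D.Adj v v) (c : ℕ)
    (hc : ∀ (a : V) (l : List V), (a :: l).Nodup → (a :: (l ++ [a])).IsChain D.Adj →
      l.length ≤ c) :
    D.toSimpleGraphInclusive.Colorable (c ^ 2 + 1) := by
  classical
  obtain ⟨A, hsub, hacyc, hback⟩ := D.exists_maximal_acyclic hirr
  let w : V → V → ℤ := fun u v => if A u v then 1 else -c
  have hw1 : ∀ l : List V, l ≠ [] → walkWeight w l ≤ (l.length : ℤ) - 1 := by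
    intro l
    induction l with
    | nil => simp
    | cons a l ih =>
      intro _
      cases l with
      | nil => simp [walkWeight]
      | cons b l =>
        have := ih (by simp)
        have hab : w a b ≤ 1 := by simp only [w]; split_ifs <;> omega
        simp only [walkWeight, List.length_cons, Nat.cast_add, Nat.cast_one] at this ⊢
        omega
  have hw2 : ∀ l : List V, l.IsChain A ∨ walkWeight w l ≤ (l.length : ℤ) - 1 - (c + 1) := by
    intro l
    induction l with
    | nil => simp
    | cons a l ih =>
      cases l with
      | nil => simp
      | cons b l =>
        by_cases hab : A a b
        · have h1 : w a b = 1 := if_pos hab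
          refine ih.imp (fun h => List.isChain_cons_cons.2 ⟨hab, h⟩) fun h => ?_
          simp only [walkWeight, List.length_cons, Nat.cast_add, Nat.cast_one] at h ⊢
          omega
        · right
          have h1 : w a b = -c := if_neg hab
          have := hw1 (b :: l) (by simp)
          simp only [walkWeight, List.length_cons, Nat.cast_add, Nat.cast_one] at this ⊢
          omega
  obtain ⟨f, hf⟩ := exists_potential hD w (by
    intro a l hnd hch
    rcases hw2 (a :: (l ++ [a])) with h | h
    · exact absurd (transGen_of_isChain h) (hacyc a)
    · have := hc a l hnd hch
      simp only [List.length_cons, List.length_append, List.length_nil] at h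
      push_cast at h
      omega)
  have hA : ∀ u v, D.Adj u v → A u v → f v + 1 ≤ f u := by
    intro u v huv h
    have := hf u v huv
    simp only [w, if_pos h] at this
    omega
  have hlow : ∀ u v, D.Adj u v → f v - c ≤ f u := by
    intro u v huv
    have := hf u v huv
    simp only [w] at this
    split_ifs at this <;> omega
  have htrans : ∀ u v, Relation.TransGen A u v → f v + 1 ≤ f u := by
    intro u v h
    induction h with
    | single h => exact hA _ _ (hsub _ _ h) h
    | tail _ h ih =>
      have := hA _ _ (hsub _ _ h) h
      omega
  have hpath : ∀ (P : List V) (x y : V), D.IsDipath x y P →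
      f y ≤ f x + c * ((P.length : ℤ) - 1) := by
    intro P
    induction P with
    | nil => intro x y h; simpa using h.head
    | cons a P ih =>
      intro x y h
      obtain rfl : a = x := by simpa using h.head
      cases P with
      | nil =>
        obtain rfl : a = y := by simpa using h.last
        simp
      | cons b P =>
        have hch := List.isChain_cons_cons.1 h.chain
        have h1 := ih b y ⟨rfl, by simpa [List.getLast?_cons_cons] using h.last,
          (List.nodup_cons.1 h.nodup).2, hch.2⟩
        have h2 := hlow a b hch.1
        simp only [List.length_cons, Nat.cast_add, Nat.cast_one] at h1 ⊢
        linarith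
  have hupp : ∀ u v, D.Adj u v → f u ≤ f v + c ^ 2 := by
    intro u v huv
    obtain ⟨P, hP⟩ := hD v u
    have h1 := hpath P v u hP
    obtain ⟨R, rfl⟩ : ∃ R, P = v :: R := by
      cases P with
      | nil => simpa using hP.head
      | cons a R => exact ⟨R, by simpa using hP.head⟩
    have h2 := hc v R hP.nodup (by
      rw [← List.cons_append]
      refine List.isChain_append.2 ⟨hP.chain, by simp, ?_⟩
      intro a ha b hb
      rw [hP.last] at ha
      cases ha
      obtain rfl : v = b := by simpa using hb
      exact huv)
    simp only [List.length_cons, Nat.cast_add, Nat.cast_one, add_sub_cancel_right] at h1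
    have : (c : ℤ) * R.length ≤ c * c := by gcongr
    linarith [sq (c : ℤ)]
  have hne : ∀ u v, D.Adj u v → f u ≠ f v ∧ |f u - f v| ≤ c ^ 2 := by
    intro u v huv
    have h1 := hupp u v huv
    have h2 := hlow u v huv
    have h3 : (c : ℤ) ≤ c ^ 2 := by exact_mod_cast Nat.le_self_pow two_ne_zero c
    refine ⟨?_, abs_le.2 ⟨by linarith, by linarith⟩⟩
    by_cases h : A u v
    · have := hA u v huv h
      omega
    · have := htrans v u (hback u v huv h)
      omega
  have hcol : ∀ u v, D.Adj u v → (f u : ZMod (c ^ 2 + 1)) ≠ f v := by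
    intro u v huv h
    obtain ⟨h1, h2⟩ := hne u v huv
    have h3 := (ZMod.intCast_eq_intCast_iff_dvd_sub _ _ _).1 h
    have h4 := Int.eq_zero_of_abs_lt_dvd h3 (by
      rw [abs_sub_comm]
      push_cast
      omega)
    omega
  have hC : D.toSimpleGraphInclusive.Coloring (ZMod (c ^ 2 + 1)) :=
    SimpleGraph.Coloring.mk (fun v => (f v : ZMod (c ^ 2 + 1))) (by
      rintro u v ⟨-, h | h⟩
      · exact hcol u v h
      · exact (hcol v u h).symm)
  simpa [ZMod.card] using hC.colorable

end Digraph

namespace Digraph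

variable {V ι : Type*}

/-- The digraph obtained by contracting the parts of a partition, without loops. -/
def quotient (D : Digraph V) (π : V → ι) : Digraph ι :=
  ⟨fun a b => a ≠ b ∧ ∃ u v, π u = a ∧ π v = b ∧ D.Adj u v⟩

theorem IsStrong.quotient {D : Digraph V} (hD : D.IsStrong) {π : V → ι}
    (hπ : Function.Surjective π) : (D.quotient π).IsStrong := by
  refine .of_reflTransGen fun x y => ?_
  obtain ⟨u, rfl⟩ := hπ x
  obtain ⟨v, rfl⟩ := hπ y
  obtain ⟨P, hP⟩ := hD u v
  have h := hP.reflTransGen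
  clear hP
  induction h with
  | refl => exact .refl
  | @tail b c _ h ih =>
    by_cases hbc : π b = π c
    · rwa [← hbc]
    · exact ih.tail ⟨hbc, b, c, rfl, rfl, h⟩

/-- Paths of the quotient lift to paths through the corresponding parts. -/
theorem IsDipath.lift {D : Digraph V} {π : V → ι}
    (hpart : ∀ u v, π u = π v → D.HasPath {x | π x = π u} u v 0) {P : List ι} {u v : V}
    (h : (D.quotient π).IsDipath (π u) (π v) P) :
    D.HasPath {x | π x ∈ P} u v (pathLength P) := by
  induction P generalizing u with
  | nil => simpa using h.head
  | cons a P ih =>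
    obtain rfl : a = π u := by simpa using h.head
    cases P with
    | nil =>
      have huv : π u = π v := by simpa using h.last
      exact (hpart u v huv).mono (fun x hx => by simpa using hx) (by simp [pathLength])
    | cons b P =>
      have hch := List.isChain_cons_cons.1 h.chain
      obtain ⟨hne, s, t, hs, rfl, hst⟩ := hch.1
      have hnd := List.nodup_cons.1 h.nodup
      have h₁ := hpart u s hs.symm
      have h₂ := ih (u := t) ⟨rfl, by simpa [List.getLast?_cons_cons] using h.last, hnd.2, hch.2⟩
      have hst' : s ≠ t := by rintro rfl; exact hne hs.symm
      have h₃ := (HasPath.arc hst' hst).trans h₂ (by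
        rintro x (rfl | rfl) hx
        · exact absurd (hs ▸ hx) hnd.1
        · rfl)
      have h₄ := h₁.trans h₃ (by
        intro x hx hx'
        rcases hx' with (rfl | rfl) | hx'
        · rfl
        · exact absurd hx.symm hne
        · exact absurd (hx ▸ hx') hnd.1)
      refine h₄.mono ?_ ?_
      · rintro x (hx | (rfl | rfl) | hx)
        · exact List.mem_cons.2 (Or.inl hx)
        · exact List.mem_cons.2 (Or.inl hs)
        · exact List.mem_cons.2 (Or.inr (by simp))
        · exact List.mem_cons.2 (Or.inr hx)
      · simp [pathLength]

/-- A path whose end vertices are joined to `S` and that avoids `S` yields an ear. -/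
theorem IsDipath.isEar {D : Digraph V} {L : ℕ} {S : Set V} {x y u v : V} {P : List V}
    (hP : D.IsDipath x y P) (hPS : ∀ z ∈ P, z ∉ S) (hu : u ∈ S) (hv : v ∈ S) (hux : D.Adj u x)
    (hyv : D.Adj y v) (hL : L ≤ P.length + 1) :
    D.IsEar L S (fun i => (u :: (P ++ [v])).getD i u) P.length ∧
      ∀ i, 1 ≤ i → i ≤ P.length → (u :: (P ++ [v])).getD i u ∈ P := by
  have hmid : ∀ i (h1 : 1 ≤ i) (h2 : i ≤ P.length),
      (u :: (P ++ [v])).getD i u = P[i - 1]'(by omega) := by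
    intro i h1 h2
    obtain ⟨j, rfl⟩ := Nat.exists_eq_add_of_le' h1
    rw [List.getD_cons_succ, List.getD_append _ _ _ _ (by omega), List.getD_eq_getElem _ _ (by omega)]
    rfl
  have hmem : ∀ i, 1 ≤ i → i ≤ P.length → (u :: (P ++ [v])).getD i u ∈ P := by
    intro i h1 h2
    rw [hmid i h1 h2]
    exact List.getElem_mem _
  have hchain : (u :: (P ++ [v])).IsChain D.Adj := by
    refine List.isChain_cons.2 ⟨?_, List.isChain_append.2 ⟨hP.chain, by simp, ?_⟩⟩
    · intro c hc
      rw [List.head?_append_of_ne_nil _ (List.ne_nil_of_mem hP.start_mem), hP.head] at hc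
      cases hc
      exact hux
    · intro a ha b hb
      rw [hP.last] at ha
      cases ha
      obtain rfl : v = b := by simpa using hb
      exact hyv
  refine ⟨⟨List.length_pos_of_mem hP.start_mem, hL, ?_, hu, ?_, ?_, ?_⟩, hmem⟩
  · intro i hi
    have hlen : (u :: (P ++ [v])).length = P.length + 2 := by simp
    have := List.isChain_iff_getElem.1 hchain i (by omega)
    rwa [List.getD_eq_getElem _ _ (by omega), List.getD_eq_getElem _ _ (by omega)]
  · simp only [List.getD_cons_succ]
    rw [List.getD_append_right _ _ _ _ le_rfl]
    simpa using hv
  · intro i h1 h2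
    exact hPS _ (hmem i h1 h2)
  · intro i j h1 h2 h3 h4 h
    rw [hmid i h1 h2, hmid j h3 h4] at h
    have := hP.nodup.getElem_inj_iff.1 h
    omega

theorem exists_minimal_rotation {R : ℕ → ℕ → Prop} (a : ℕ) (l : List ℕ) (hnd : (a :: l).Nodup)
    (hch : (a :: (l ++ [a])).IsChain R) : ∃ b l', l'.length = l.length ∧ (b :: l').Nodup ∧
      (b :: (l' ++ [b])).IsChain R ∧ ∀ c ∈ l', b < c := by
  obtain ⟨b, hb, hmin⟩ := (a :: l).toFinset.exists_min_image id ⟨a, by simp⟩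
  obtain ⟨l₁, l₂, h⟩ := List.append_of_mem (List.mem_toFinset.1 hb)
  have hrot : (a :: l) ~r (b :: (l₂ ++ l₁)) := by
    rw [h]
    exact List.isRotated_append
  have hnd' := hrot.perm.nodup_iff.1 hnd
  refine ⟨b, l₂ ++ l₁, ?_, hnd', ?_, ?_⟩
  · simpa using hrot.perm.length_eq.symm
  · rw [← Cycle.chain_coe_cons] at hch ⊢
    rwa [← Cycle.coe_eq_coe.2 hrot]
  · intro c hc
    refine lt_of_le_of_ne (hmin c ?_) ?_
    · exact List.mem_toFinset.2 (hrot.perm.mem_iff.2 (List.mem_cons_of_mem _ hc))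
    · rintro rfl
      exact (List.nodup_cons.1 hnd').1 hc

/-- If no ear of length `L` can be attached to a part via later parts, then the cycles of the
quotient are short. -/
theorem quotient_cycle_length_lt {D : Digraph V} {π : V → ℕ} {L : ℕ} (hL : 2 ≤ L)
    (hpart : ∀ u v, π u = π v → D.HasPath {x | π x = π u} u v 0)
    (hear : ∀ (i m : ℕ) (f : ℕ → V), D.IsEar L {u | π u = i} f m →
      ¬ ∀ j, 1 ≤ j → j ≤ m → i < π (f j))
    (a : ℕ) (l : List ℕ) (hnd : (a :: l).Nodup)
    (hch : (a :: (l ++ [a])).IsChain (D.quotient π).Adj) : l.length + 2 ≤ L := by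
  obtain ⟨b, l', hlen, hnd', hch', hmin⟩ := exists_minimal_rotation a l hnd hch
  rw [← hlen]
  by_contra hlt
  cases l' with
  | nil => simp at hlt; omega
  | cons c l' =>
    have h₁ := List.isChain_cons_cons.1 hch'
    have h₂ := List.isChain_append.1 (show ((c :: l') ++ [b]).IsChain (D.quotient π).Adj from h₁.2)
    obtain ⟨-, u, x, hu, hx, hux⟩ := h₁.1
    obtain ⟨-, y, v, hy, hv, hyv⟩ := h₂.2.2 ((c :: l').getLast (by simp))
      (List.getLast?_eq_getLast_of_ne_nil _) b (by simp)
    obtain ⟨P, hP, hPmem, hPlen⟩ := IsDipath.lift hpart (u := x) (v := y) (P := c :: l')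
      ⟨by simp [hx], by rw [hy]; exact List.getLast?_eq_getLast_of_ne_nil _,
        (List.nodup_cons.1 hnd').2, h₂.1⟩
    have hgt : ∀ z ∈ P, b < π z := fun z hz => hmin _ (hPmem z hz)
    have hpos := List.length_pos_of_mem hP.start_mem
    obtain ⟨hE, hmem⟩ := hP.isEar (L := L) (S := {u | π u = b}) (u := u) (v := v)
      (fun z hz h => (hgt z hz).ne h.symm) hu hv hux hyv (by
        simp only [pathLength, List.length_cons] at hPlen hlt
        omega)
    exact hear b _ _ hE fun j h1 h2 => hgt _ (hmem j h1 h2)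

/-- Colourings of the quotient and of the parts combine to a colouring. -/
theorem colorable_of_quotient {ι : Type*} {D : Digraph V} {π : V → ι} {m n : ℕ}
    (hq : (D.quotient π).toSimpleGraphInclusive.Colorable m)
    (hp : ∀ i, (D.induce {u | π u = i}).toSimpleGraphInclusive.Colorable n) :
    D.toSimpleGraphInclusive.Colorable (m * n) := by
  obtain ⟨f⟩ := hq
  have g i := (hp i).some
  have hC : D.toSimpleGraphInclusive.Coloring (Fin m × Fin n) :=
    SimpleGraph.Coloring.mk (fun v => (f (π v), g (π v) ⟨v, rfl⟩)) (by
      rintro u v ⟨hne, hadj⟩ h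
      obtain ⟨h₁, h₂⟩ := Prod.mk.inj h
      by_cases huv : π u = π v
      · have hgv : ∀ i (hu : π u = i) (hv : π v = i), g i ⟨u, hu⟩ ≠ g i ⟨v, hv⟩ :=
          fun i hu hv => (g i).valid ⟨fun h => hne (congrArg Subtype.val h), hadj⟩
        have hcongr : ∀ i (hv : π v = i), g (π v) ⟨v, rfl⟩ = g i ⟨v, hv⟩ := by
          rintro i rfl
          rfl
        exact hgv _ rfl huv.symm (h₂.trans (hcongr _ huv.symm))
      · refine f.valid ⟨huv, hadj.imp ?_ ?_⟩ h₁
        · exact fun h => ⟨huv, u, v, rfl, rfl, h⟩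
        · exact fun h => ⟨Ne.symm huv, v, u, rfl, rfl, h⟩)
  simpa using hC.colorable

theorem colorable_of_not_containsBispindle [Finite V] {D : Digraph V} (hD : D.IsStrong) {k : ℕ}
    (hk : 2 ≤ k) (hfree : ¬ D.ContainsBispindle k 1 k) :
    D.toSimpleGraphInclusive.Colorable (((2 * k - 2) ^ 2 + 1) * earSystemBound k) := by
  obtain ⟨π, hπ, hear⟩ := D.exists_ear_partition (2 * k) Set.univ
  simp only [Set.mem_univ, true_and, forall_const] at hπ hear
  have hpart : ∀ u v, π u = π v → D.HasPath {x | π x = π u} u v 0 := by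
    intro u v huv
    obtain ⟨r, ⟨E⟩⟩ := hπ u
    obtain ⟨P, hP⟩ := E.toEarSystem.isStrong ⟨u, rfl⟩ ⟨v, huv.symm⟩
    refine ⟨_, hP.of_induce, fun z hz => ?_, Nat.zero_le _⟩
    obtain ⟨w, -, rfl⟩ := List.mem_map.1 hz
    exact w.2
  refine colorable_of_quotient (π := Set.rangeFactorization π) ?_ ?_
  · refine colorable_of_cycle_length_le (hD.quotient Set.rangeFactorization_surjective)
      (fun v h => h.1 rfl) _ fun a l hnd hch => ?_
    have := quotient_cycle_length_lt (L := 2 * k) (by omega) hpart hear a (l.map Subtype.val)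
      (hnd.map Subtype.val_injective) (by
        have := (List.isChain_map Subtype.val (R := (D.quotient π).Adj)).2 (hch.imp
          (fun x y ⟨hne, u, v, hu, hv, h⟩ => ⟨fun h' => hne (Subtype.ext h'), u, v,
            congrArg Subtype.val hu, congrArg Subtype.val hv, h⟩))
        simpa using this)
    rw [List.length_map] at this
    omega
  · rintro ⟨i, v, rfl⟩
    obtain ⟨r, ⟨E⟩⟩ := hπ v
    have hset : {u | Set.rangeFactorization π u = ⟨π v, v, rfl⟩} = {u | π u = π v} := by
      ext u
      exact Subtype.ext_iff
    rw [hset]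
    exact E.toEarSystem.colorable hk fun h => hfree h.of_induce

theorem le_bispindleBound {k : ℕ} (hk : 2 ≤ k) :
    ((2 * k - 2) ^ 2 + 1) * earSystemBound k ≤ bispindleBound k := by
  have h1 : (2 * k - 2) ^ 2 + 1 ≤ 8 * k ^ 2 := by
    have : (2 * k - 2) ^ 2 ≤ (2 * k) ^ 2 := Nat.pow_le_pow_left (Nat.sub_le _ _) 2
    nlinarith
  have h2 : earSystemBound k ≤ 2 * (4 * k) ^ (4 * k) + 1 := by
    have h3 : k ^ 5 ≤ (4 * k) ^ (4 * k - 1) :=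
      (Nat.pow_le_pow_left (by omega) 5).trans (Nat.pow_le_pow_right (by omega) (by omega))
    have h4 : (4 * k) ^ (4 * k) = (4 * k) ^ (4 * k - 1) * (4 * k) := by
      rw [← pow_succ]
      congr 1
      omega
    have h5 : k ≤ k ^ 5 := Nat.le_self_pow (by norm_num) k
    have h6 : (4 * k) ^ (4 * k - 1) * 8 ≤ (4 * k) ^ (4 * k - 1) * (4 * k) :=
      Nat.mul_le_mul_left _ (by omega)
    unfold earSystemBound
    omega
  unfold bispindleBound
  calc ((2 * k - 2) ^ 2 + 1) * earSystemBound k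
      ≤ 8 * k ^ 2 * (2 * (4 * k) ^ (4 * k) + 1) := Nat.mul_le_mul h1 h2
    _ ≤ 8 * k ^ 2 * (4 * k ^ 2 + 2) * (2 * (4 * k) ^ (4 * k) + 1) :=
      Nat.mul_le_mul_right _ (Nat.le_mul_of_pos_right _ (by omega))
    _ ≤ _ := Nat.le_mul_of_pos_right _ (by
      have : 0 < 14 * k := by omega
      omega)

end Digraph

theorem theorem4 (k : ℕ) (hk : 1 ≤ k) {V : Type*} [Finite V] (D : Digraph V) (hD : D.IsStrong)
    (hchi : (Digraph.bispindleBound k : ℕ∞) < D.chi) : D.ContainsBispindle k 1 k := by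
  by_contra hfree
  have hcol : D.toSimpleGraphInclusive.Colorable (Digraph.bispindleBound k) := by
    rcases Nat.eq_or_lt_of_le hk with rfl | hk
    · refine (Digraph.colorable_of_not_containsBispindle hD le_rfl fun h =>
        hfree (h.mono one_le_two le_rfl one_le_two)).mono ?_
      norm_num [Digraph.earSystemBound, Digraph.bispindleBound]
    · exact (Digraph.colorable_of_not_containsBispindle hD hk hfree).mono
        (Digraph.le_bispindleBound hk)
  exact absurd hchi (not_lt.2 hcol.chromaticNumber_le)
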